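/- Let $G$ be a tree on $n\ge 1$ nodes, bidirected (every edge $uv$ gives the arcs $uv$ and $vu$), let $0<\alpha<1$ and let $q$ be a probability distribution on the nodes. The payoff of a node is its PageRank: its probability in the stationary distribution of the walk that at each step jumps with probability $\alpha$ to a random node distributed as $q$ and otherwise follows a uniformly random outlink of the current node (at a node without outlinks it stays there until the next jump). In the request-delete model a strategy of a node $v$ consists of a set $E_v$ of neighbours of $v$ and a set $F_v$ of nodes other than $v$ that are not neighbours of $v$, with $E_v\cup F_v\neq\emptyset$: the edges between $v$ and its neighbours outside $E_v$ are deleted in both directions, and a directed outlink from $v$ to each node of $F_v$ is added. The strategy is improving if the PageRank of $v$ in the resulting digraph is strictly greater than in $G$; $G$ is a Nash equilibrium if no node has an improving strategy. There is an algorithm (a fixed real-RAM program with unit-cost integer addition, subtraction and comparison, unit-cost real arithmetic and comparison, and unit-cost memory access) which, for every such input $(G,\alpha,q)$ with $G$ given by its adjacency matrix, determines in $O(n^3)$ time, with an absolute constant, whether $G$ is a Nash equilibrium in the request-delete model, and if it is not, outputs a node $v$ together with an improving strategy $(E_v,F_v)$ of $v$. -/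

import Mathlib

namespace PageRankGame

/-! ### PageRank of a finite digraph -/

section PageRank

variable {V : Type*} [Fintype V]

open Classical in
/-- The set `Γ(u)` of out-neighbours of `u`. -/
noncomputable def outNbrs (D : Digraph V) (u : V) : Finset V :=
  Finset.univ.filter (fun w => D.Adj u w)

open Classical in
/-- One step along the outlinks: from `u` move to a uniformly random out-neighbour.
A walk at a node without outlinks stays there (until the next random jump). -/
noncomputable def linkStep (D : Digraph V) (u w : V) : ℝ :=
  if (outNbrs D u).card = 0 then (if w = u then 1 else 0)
  else if D.Adj u w then 1 / ((outNbrs D u).card : ℝ) else 0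

/-- Transition probability `u → w` of the `α`-random walk: with probability `α` jump to a node
drawn from `q`, otherwise follow an outlink. -/
noncomputable def walkStep (D : Digraph V) (α : ℝ) (q : V → ℝ) (u w : V) : ℝ :=
  α * q w + (1 - α) * linkStep D u w

/-- `π` is a stationary distribution of the `α`-random walk on `D`. -/
def IsPageRank (D : Digraph V) (α : ℝ) (q π : V → ℝ) : Prop :=
  π ∈ stdSimplex ℝ V ∧ ∀ w, ∑ u, π u * walkStep D α q u w = π w

/-- The PageRank vector: the stationary distribution of the `α`-random walk. For `0 < α < 1` and
`q` a probability distribution it exists and is unique, see `existsUnique_isPageRank`. -/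
noncomputable def pageRank (D : Digraph V) (α : ℝ) (q : V → ℝ) : V → ℝ :=
  Classical.epsilon (IsPageRank D α q)

theorem linkStep_nonneg (D : Digraph V) (u w : V) : 0 ≤ linkStep D u w := by
  unfold linkStep
  split_ifs <;> positivity

theorem sum_linkStep (D : Digraph V) (u : V) : ∑ w, linkStep D u w = 1 := by
  classical
  by_cases h : (outNbrs D u).card = 0
  · simp [linkStep, h]
  · have h' : ((outNbrs D u).card : ℝ) ≠ 0 := by exact_mod_cast h
    simp only [linkStep, h, if_false]
    rw [← Finset.sum_filter, Finset.sum_const, nsmul_eq_mul]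
    have : (Finset.univ.filter (fun w => D.Adj u w)).card = (outNbrs D u).card := by
      unfold outNbrs; congr
    rw [this]
    field_simp

theorem sum_sum_linkStep (D : Digraph V) (x : V → ℝ) :
    ∑ w, ∑ u, x u * linkStep D u w = ∑ u, x u := by
  rw [Finset.sum_comm]
  exact Finset.sum_congr rfl fun u _ => by rw [← Finset.mul_sum, sum_linkStep, mul_one]

/-- A fixed point of the affine PageRank equation is bounded in `ℓ¹` by the jump vector. -/
theorem sum_abs_le_of_fixed (D : Digraph V) {α : ℝ} (h0 : 0 < α) (h1 : α < 1) (b x : V → ℝ)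
    (hx : ∀ w, x w = α * b w + (1 - α) * ∑ u, x u * linkStep D u w) :
    ∑ w, |x w| ≤ ∑ w, |b w| := by
  have key : ∀ w, |x w| ≤ α * |b w| + (1 - α) * ∑ u, |x u| * linkStep D u w := by
    intro w
    have hs : |∑ u, x u * linkStep D u w| ≤ ∑ u, |x u| * linkStep D u w := by
      refine (Finset.abs_sum_le_sum_abs _ _).trans (le_of_eq ?_)
      exact Finset.sum_congr rfl fun u _ => by
        rw [abs_mul, abs_of_nonneg (linkStep_nonneg D u w)]
    calc |x w| = |α * b w + (1 - α) * ∑ u, x u * linkStep D u w| := by rw [← hx w]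
      _ ≤ |α * b w| + |(1 - α) * ∑ u, x u * linkStep D u w| := abs_add_le _ _
      _ = α * |b w| + (1 - α) * |∑ u, x u * linkStep D u w| := by
          rw [abs_mul, abs_mul, abs_of_pos h0, abs_of_pos (by linarith : 0 < 1 - α)]
      _ ≤ _ := by
          have := mul_le_mul_of_nonneg_left hs (by linarith : 0 ≤ 1 - α)
          linarith
  have hsum := Finset.sum_le_sum fun w (_ : w ∈ Finset.univ) => key w
  rw [Finset.sum_add_distrib, ← Finset.mul_sum, ← Finset.mul_sum, sum_sum_linkStep] at hsum
  nlinarith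

/-- Existence and uniqueness of the PageRank vector. -/
theorem existsUnique_isPageRank (D : Digraph V) {α : ℝ} (h0 : 0 < α) (h1 : α < 1) {q : V → ℝ}
    (hq : q ∈ stdSimplex ℝ V) : ∃! π, IsPageRank D α q π := by
  have step : ∀ x : V → ℝ, ∑ u, x u = 1 → ∀ w,
      ∑ u, x u * walkStep D α q u w = α * q w + (1 - α) * ∑ u, x u * linkStep D u w := by
    intro x hx w
    have : ∀ u, x u * walkStep D α q u w
        = x u * (α * q w) + (1 - α) * (x u * linkStep D u w) := by
      intro u; unfold walkStep; ring
    simp_rw [this]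
    rw [Finset.sum_add_distrib, ← Finset.sum_mul, hx, one_mul, ← Finset.mul_sum]
  have hzero : ∀ x : V → ℝ, (∀ w, x w = (1 - α) * ∑ u, x u * linkStep D u w) → x = 0 := by
    intro x hx
    have h := sum_abs_le_of_fixed D h0 h1 0 x (fun w => by simpa using hx w)
    simp only [Pi.zero_apply, abs_zero, Finset.sum_const_zero] at h
    have h' := (Finset.sum_eq_zero_iff_of_nonneg (fun w _ => abs_nonneg (x w))).1
      (le_antisymm h (Finset.sum_nonneg fun w _ => abs_nonneg (x w)))
    funext w
    exact abs_eq_zero.1 (h' w (Finset.mem_univ w))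
  let L : (V → ℝ) →ₗ[ℝ] (V → ℝ) :=
    { toFun := fun x w => x w - (1 - α) * ∑ u, x u * linkStep D u w
      map_add' := by
        intro x y; funext w
        simp only [Pi.add_apply, add_mul, Finset.sum_add_distrib]; ring
      map_smul' := by
        intro c x; funext w
        simp only [Pi.smul_apply, smul_eq_mul, RingHom.id_apply, mul_assoc, ← Finset.mul_sum]
        ring }
  have hinj : Function.Injective L := by
    rw [injective_iff_map_eq_zero]
    intro x hx
    exact hzero x fun w => sub_eq_zero.1 (congrFun hx w)
  obtain ⟨x, hx⟩ := LinearMap.injective_iff_surjective.1 hinj (fun w => α * q w)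
  have hfix : ∀ w, x w = α * q w + (1 - α) * ∑ u, x u * linkStep D u w := by
    intro w
    have := congrFun hx w
    simp only [L, LinearMap.coe_mk, AddHom.coe_mk] at this
    linarith
  have hsum : ∑ w, x w = 1 := by
    have h := Finset.sum_congr rfl fun w (_ : w ∈ Finset.univ) => hfix w
    rw [Finset.sum_add_distrib, ← Finset.mul_sum, ← Finset.mul_sum, sum_sum_linkStep, hq.2] at h
    nlinarith
  have hnn : ∀ w, 0 ≤ x w := by
    have hb := sum_abs_le_of_fixed D h0 h1 q x hfix
    have hqa : ∑ w, |q w| = 1 := by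
      rw [← hq.2]; exact Finset.sum_congr rfl fun w _ => abs_of_nonneg (hq.1 w)
    have hz : ∑ w, (|x w| - x w) = 0 := by
      refine le_antisymm ?_ (Finset.sum_nonneg fun w _ => sub_nonneg.2 (le_abs_self _))
      rw [Finset.sum_sub_distrib, hsum]; linarith
    have h := (Finset.sum_eq_zero_iff_of_nonneg
      (fun w _ => sub_nonneg.2 (le_abs_self (x w)))).1 hz
    intro w
    rw [← sub_eq_zero.1 (h w (Finset.mem_univ w))]
    exact abs_nonneg _
  refine ⟨x, ⟨⟨hnn, hsum⟩, fun w => by rw [step x hsum w, ← hfix w]⟩, ?_⟩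
  rintro y ⟨⟨-, hy⟩, hyfix⟩
  have : y - x = 0 := hzero _ fun w => by
    have h2 := hyfix w
    rw [step y hy w] at h2
    have h3 := hfix w
    simp only [Pi.sub_apply, sub_mul, Finset.sum_sub_distrib]
    linarith
  exact sub_eq_zero.1 this

theorem isPageRank_pageRank (D : Digraph V) {α : ℝ} (h0 : 0 < α) (h1 : α < 1) {q : V → ℝ}
    (hq : q ∈ stdSimplex ℝ V) : IsPageRank D α q (pageRank D α q) :=
  Classical.epsilon_spec (existsUnique_isPageRank D h0 h1 hq).exists

end PageRank

/-! ### The request-delete model on an undirected graph -/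

section Game

variable {V : Type*}

/-- The bidirected graph of `G`: every edge `uv` gives the two arcs `uv` and `vu`. -/
def bidirected (G : SimpleGraph V) : Digraph V where
  Adj u w := G.Adj u w

/-- A strategy of player `v`: a set `E` of neighbours whose (bidirectional) edge is retained and a
set `F` of non-neighbours to which `v` creates a directed outlink; `v` keeps at least one outlink,
and there are no loops. -/
structure IsStrategy (G : SimpleGraph V) (v : V) (E F : Set V) : Prop where
  retained : ∀ u ∈ E, G.Adj v u
  requested : ∀ u ∈ F, ¬ G.Adj v u ∧ u ≠ v
  nonempty : (E ∪ F).Nonempty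

/-- The digraph that results from `G` when `v` plays `(E, F)`. Deleting an edge `vu` with `u ∉ E`
removes both arcs; an outlink to `u ∈ F` adds only the arc from `v` to `u`. -/
def play (G : SimpleGraph V) (v : V) (E F : Set V) : Digraph V where
  Adj a b := (a = v ∧ (b ∈ E ∨ b ∈ F)) ∨ (a ≠ v ∧ G.Adj a b ∧ (b = v → a ∈ E))

variable [Fintype V]

/-- `(E, F)` is a strategy of `v` that strictly increases the PageRank of `v`. -/
def IsImproving (G : SimpleGraph V) (α : ℝ) (q : V → ℝ) (v : V) (E F : Set V) : Prop :=
  IsStrategy G v E F ∧ pageRank (bidirected G) α q v < pageRank (play G v E F) α q v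

/-- `v` is in best response in the request-delete model. -/
def IsBestResponse (G : SimpleGraph V) (α : ℝ) (q : V → ℝ) (v : V) : Prop :=
  ∀ E F : Set V, IsStrategy G v E F →
    pageRank (play G v E F) α q v ≤ pageRank (bidirected G) α q v

/-- `G` is a Nash equilibrium in the request-delete model. -/
def IsNash (G : SimpleGraph V) (α : ℝ) (q : V → ℝ) : Prop :=
  ∀ v, IsBestResponse G α q v

end Game

/-! ### A real RAM with unit costs

Programs are finite texts working on integer and real variables and on integer and real arrays.
Arrays are addressed by integers. Every arithmetic operation (`+`, truncated `-` on natural numbers;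
`+`, `-`, `*`, `/` on real numbers), comparison, memory access and control step has cost one.
There is no conversion between the two sorts and no real constant other than `0` and `1`. -/

/-- A memory state. -/
structure State where
  /-- integer variables -/
  nvar : ℕ → ℕ
  /-- real variables -/
  rvar : ℕ → ℝ
  /-- integer arrays: `narr a k` is entry `k` of array `a` -/
  narr : ℕ → ℕ → ℕ
  /-- real arrays: `rarr a k` is entry `k` of array `a` -/
  rarr : ℕ → ℕ → ℝ

/-- Integer expressions. -/
inductive NExp where
  | const (k : ℕ)
  | var (i : ℕ)
  | get (a : ℕ) (idx : NExp)
  | add (e f : NExp)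
  | sub (e f : NExp)

/-- Value of an integer expression. -/
def NExp.eval (s : State) : NExp → ℕ
  | .const k => k
  | .var i => s.nvar i
  | .get a idx => s.narr a (idx.eval s)
  | .add e f => e.eval s + f.eval s
  | .sub e f => e.eval s - f.eval s

/-- Cost of evaluating an integer expression: its number of nodes. -/
def NExp.cost : NExp → ℕ
  | .const _ => 1
  | .var _ => 1
  | .get _ idx => idx.cost + 1
  | .add e f => e.cost + f.cost + 1
  | .sub e f => e.cost + f.cost + 1

/-- Real expressions. -/
inductive RExp where
  | zero
  | one
  | var (i : ℕ)
  | get (a : ℕ) (idx : NExp)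
  | add (e f : RExp)
  | sub (e f : RExp)
  | mul (e f : RExp)
  | div (e f : RExp)

/-- Value of a real expression. -/
noncomputable def RExp.eval (s : State) : RExp → ℝ
  | .zero => 0
  | .one => 1
  | .var i => s.rvar i
  | .get a idx => s.rarr a (idx.eval s)
  | .add e f => e.eval s + f.eval s
  | .sub e f => e.eval s - f.eval s
  | .mul e f => e.eval s * f.eval s
  | .div e f => e.eval s / f.eval s

/-- Cost of evaluating a real expression: its number of nodes. -/
def RExp.cost : RExp → ℕ
  | .zero => 1
  | .one => 1
  | .var _ => 1
  | .get _ idx => idx.cost + 1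
  | .add e f => e.cost + f.cost + 1
  | .sub e f => e.cost + f.cost + 1
  | .mul e f => e.cost + f.cost + 1
  | .div e f => e.cost + f.cost + 1

/-- Tests. -/
inductive Test where
  | nlt (e f : NExp)
  | rlt (e f : RExp)
  | not (b : Test)
  | and (b c : Test)

/-- Truth of a test. -/
def Test.Holds (s : State) : Test → Prop
  | .nlt e f => e.eval s < f.eval s
  | .rlt e f => e.eval s < f.eval s
  | .not b => ¬ b.Holds s
  | .and b c => b.Holds s ∧ c.Holds s

/-- Cost of evaluating a test: its number of nodes. -/
def Test.cost : Test → ℕ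
  | .nlt e f => e.cost + f.cost + 1
  | .rlt e f => e.cost + f.cost + 1
  | .not b => b.cost + 1
  | .and b c => b.cost + c.cost + 1

/-- Programs; `loop b p` repeats `p` while `b` holds. -/
inductive Prog where
  | skip
  | setN (i : ℕ) (e : NExp)
  | setR (i : ℕ) (e : RExp)
  | putN (a : ℕ) (idx : NExp) (e : NExp)
  | putR (a : ℕ) (idx : NExp) (e : RExp)
  | seq (p r : Prog)
  | ite (b : Test) (p r : Prog)
  | loop (b : Test) (p : Prog)

/-- `Runs p s s' t`: started in state `s`, the program `p` halts in state `s'` after exactly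
`t` steps. -/
inductive Runs : Prog → State → State → ℕ → Prop where
  | skip (s : State) : Runs .skip s s 1
  | setN (s : State) (i : ℕ) (e : NExp) :
      Runs (.setN i e) s { s with nvar := Function.update s.nvar i (e.eval s) } (e.cost + 1)
  | setR (s : State) (i : ℕ) (e : RExp) :
      Runs (.setR i e) s { s with rvar := Function.update s.rvar i (e.eval s) } (e.cost + 1)
  | putN (s : State) (a : ℕ) (idx e : NExp) :
      Runs (.putN a idx e) s
        { s with
          narr := Function.update s.narr a
            (Function.update (s.narr a) (idx.eval s) (e.eval s)) }
        (idx.cost + e.cost + 1)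
  | putR (s : State) (a : ℕ) (idx : NExp) (e : RExp) :
      Runs (.putR a idx e) s
        { s with
          rarr := Function.update s.rarr a
            (Function.update (s.rarr a) (idx.eval s) (e.eval s)) }
        (idx.cost + e.cost + 1)
  | seq {p r : Prog} {s₁ s₂ s₃ : State} {t₁ t₂ : ℕ} :
      Runs p s₁ s₂ t₁ → Runs r s₂ s₃ t₂ → Runs (.seq p r) s₁ s₃ (t₁ + t₂)
  | ite_true {b : Test} {p r : Prog} {s s' : State} {t : ℕ} :
      b.Holds s → Runs p s s' t → Runs (.ite b p r) s s' (b.cost + t + 1)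
  | ite_false {b : Test} {p r : Prog} {s s' : State} {t : ℕ} :
      ¬ b.Holds s → Runs r s s' t → Runs (.ite b p r) s s' (b.cost + t + 1)
  | loop_true {b : Test} {p : Prog} {s₁ s₂ s₃ : State} {t₁ t₂ : ℕ} :
      b.Holds s₁ → Runs p s₁ s₂ t₁ → Runs (.loop b p) s₂ s₃ t₂ →
      Runs (.loop b p) s₁ s₃ (b.cost + t₁ + t₂ + 1)
  | loop_false {b : Test} {p : Prog} {s : State} :
      ¬ b.Holds s → Runs (.loop b p) s s (b.cost + 1)

/-! ### Input and output -/

open Classical in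
/-- The input `(G, α, q)`: integer variable `0` holds `n`, integer array `0` holds the adjacency
matrix of `G` row by row, real variable `0` holds `α` and real array `0` holds `q`. All other
memory is zero. -/
noncomputable def input {n : ℕ} (G : SimpleGraph (Fin n)) (α : ℝ) (q : Fin n → ℝ) : State where
  nvar i := if i = 0 then n else 0
  rvar i := if i = 0 then α else 0
  narr a k := if a = 0 ∧ ∃ u w : Fin n, k = (u : ℕ) * n + (w : ℕ) ∧ G.Adj u w then 1 else 0
  rarr a k := if h : a = 0 ∧ k < n then q ⟨k, h.2⟩ else 0

/-- The yes/no answer is read in integer variable `0`. -/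
def State.answer (s : State) : ℕ := s.nvar 0

/-- The number of the improving player is read in integer variable `1`. -/
def State.player (s : State) : ℕ := s.nvar 1

/-- The set of retained neighbours: its indicator vector is read in integer array `1`. -/
def State.retainedSet (s : State) (n : ℕ) : Set (Fin n) := {u | s.narr 1 u = 1}

/-- The set of new outlinks: its indicator vector is read in integer array `2`. -/
def State.requestedSet (s : State) (n : ℕ) : Set (Fin n) := {u | s.narr 2 u = 1}

end PageRankGame

open PageRankGame

/-! In a tree the walk from a node `w` can reach a player `v` only along the unique path. The
probability `φ w` of reaching `v` before the next jump is therefore a product of ratios, one per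
dart of the path, and each ratio satisfies a recursion over the darts behind it (`IsRatio`,
`IsHitTable.harmonic`).

Suppose `v` plays `(E, F)`, with `S = E ∪ F` and `k = |S|`. The branches at `v` outside `E` are cut
off; elsewhere the hitting probabilities `f` do not change. Summing the expected returns to `v` as a
geometric series gives the PageRank `α k M / Y`, where `M = ∑ q f` over all nodes and `Y = ∑ (1 - (1
- α) f)` over `S` (`pageRank_play`). With `c` the old PageRank divided by `α`, the strategy is
improving iff `k M - c Y > 0`. For fixed `k` this is a sum over `S` (`isImproving_iff`).

The terms still depend on `E` through `f ≤ φ`. Replacing `f` by `φ` gives an upper bound whose terms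
are the numbers `weight`, and for given `k` it is maximal on the `k` other nodes of largest weight
(`exists_topSet_of_isImproving`). On that set the bound is exact: a non-neighbour `w` of `v` weighs
strictly less than the neighbour `b w` through which it reaches `v`, so `b w` is chosen along with
`w` and its branch is not cut (`isImproving_topSet`). Hence it suffices to test one strategy for
each `v` and each `k < n`.

Sorting afresh for each of the `n²` pairs would cost a logarithm too much. But no mass reaches `v`
through a non-neighbour, so the weight of a non-neighbour does not depend on `k`. The non-neighbours
are ranked once per player, in quadratic time, and for each `k` only the neighbours are compared
with all nodes, in time `O(n + n deg v)` (`rankPhase_halts`). Since the degrees of a tree sum to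
less than `2n` (`sum_dartCount_le`), all pairs together take `O(n³)`. The ratios and the hitting
probabilities are found by `n` rounds of relaxation over the at most `2n` darts, at linear cost per
dart. -/

namespace PageRankGame

/-! ### Verification of real-RAM programs -/

/-- Started in `s`, the program `p` halts within `B` steps in a state satisfying `Q`. -/
def Halts (p : Prog) (s : State) (B : ℕ) (Q : State → Prop) : Prop :=
  ∃ s' t, Runs p s s' t ∧ t ≤ B ∧ Q s'

theorem Halts.mono {p : Prog} {s : State} {B B' : ℕ} {Q Q' : State → Prop} (h : Halts p s B Q)
    (hB : B ≤ B') (hQ : ∀ s', Q s' → Q' s') : Halts p s B' Q' := by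
  obtain ⟨s', t, hr, ht, hq⟩ := h
  exact ⟨s', t, hr, ht.trans hB, hQ _ hq⟩

theorem Halts.seq {p r : Prog} {s : State} {B C : ℕ} {Q R : State → Prop} (h : Halts p s B Q)
    (h' : ∀ s', Q s' → Halts r s' C R) : Halts (.seq p r) s (B + C) R := by
  obtain ⟨s', t, hr, ht, hq⟩ := h
  obtain ⟨s'', t', hr', ht', hq'⟩ := h' s' hq
  exact ⟨s'', t + t', .seq hr hr', add_le_add ht ht', hq'⟩

theorem Halts.ite_of_pos {b : Test} {p r : Prog} {s : State} {B : ℕ} {Q : State → Prop}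
    (hb : b.Holds s) (h : Halts p s B Q) : Halts (.ite b p r) s (b.cost + B + 1) Q := by
  obtain ⟨s', t, hr, ht, hq⟩ := h
  exact ⟨s', _, .ite_true hb hr, by omega, hq⟩

theorem Halts.ite_of_neg {b : Test} {p r : Prog} {s : State} {B : ℕ} {Q : State → Prop}
    (hb : ¬ b.Holds s) (h : Halts r s B Q) : Halts (.ite b p r) s (b.cost + B + 1) Q := by
  obtain ⟨s', t, hr, ht, hq⟩ := h
  exact ⟨s', _, .ite_false hb hr, by omega, hq⟩

/-! #### Loop-free programs -/

/-- The program contains no loop. -/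
def Prog.loopFree : Prog → Bool
  | .seq p r => p.loopFree && r.loopFree
  | .ite _ p r => p.loopFree && r.loopFree
  | .loop _ _ => false
  | _ => true

/-- Upper bound for the running time of a loop-free program. -/
def Prog.maxCost : Prog → ℕ
  | .skip => 1
  | .setN _ e => e.cost + 1
  | .setR _ e => e.cost + 1
  | .putN _ idx e => idx.cost + e.cost + 1
  | .putR _ idx e => idx.cost + e.cost + 1
  | .seq p r => p.maxCost + r.maxCost
  | .ite b p r => b.cost + (p.maxCost + r.maxCost) + 1
  | .loop _ _ => 0

open Classical in
/-- The final state of a loop-free program. -/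
noncomputable def Prog.exec : Prog → State → State
  | .skip, s => s
  | .setN i e, s => { s with nvar := Function.update s.nvar i (e.eval s) }
  | .setR i e, s => { s with rvar := Function.update s.rvar i (e.eval s) }
  | .putN a idx e, s => { s with
      narr := Function.update s.narr a (Function.update (s.narr a) (idx.eval s) (e.eval s)) }
  | .putR a idx e, s => { s with
      rarr := Function.update s.rarr a (Function.update (s.rarr a) (idx.eval s) (e.eval s)) }
  | .seq p r, s => r.exec (p.exec s)
  | .ite b p r, s => if b.Holds s then p.exec s else r.exec s
  | .loop _ _, s => s

theorem Prog.exists_runs_exec (p : Prog) (s : State) (h : p.loopFree = true) :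
    ∃ t ≤ p.maxCost, Runs p s (p.exec s) t := by
  induction p generalizing s with
  | skip => exact ⟨_, le_rfl, .skip s⟩
  | setN i e => exact ⟨_, le_rfl, .setN s i e⟩
  | setR i e => exact ⟨_, le_rfl, .setR s i e⟩
  | putN a idx e => exact ⟨_, le_rfl, .putN s a idx e⟩
  | putR a idx e => exact ⟨_, le_rfl, .putR s a idx e⟩
  | seq p r ihp ihr =>
    simp only [loopFree, Bool.and_eq_true] at h
    obtain ⟨t, ht, h1⟩ := ihp s h.1
    obtain ⟨t', ht', h2⟩ := ihr (p.exec s) h.2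
    exact ⟨t + t', add_le_add ht ht', .seq h1 h2⟩
  | ite b p r ihp ihr =>
    simp only [loopFree, Bool.and_eq_true] at h
    obtain ⟨t, ht, h1⟩ := ihp s h.1
    obtain ⟨t', ht', h2⟩ := ihr s h.2
    by_cases hb : b.Holds s
    · exact ⟨b.cost + t + 1, by simp only [maxCost]; omega, by
        simp only [exec, hb, if_true]; exact .ite_true hb h1⟩
    · exact ⟨b.cost + t' + 1, by simp only [maxCost]; omega, by
        simp only [exec, hb, if_false]; exact .ite_false hb h2⟩
  | loop b p => simp [loopFree] at h

/-- Reduces loop-free code to computation: the postcondition is checked on `exec` by simplification,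
and `maxCost`, which adds the costs of both branches of a conditional, is a closed numeral. -/
theorem Halts.of_loopFree {p : Prog} {s : State} {Q : State → Prop} (h : p.loopFree = true)
    (hQ : Q (p.exec s)) : Halts p s p.maxCost Q := by
  obtain ⟨t, ht, hr⟩ := p.exists_runs_exec s h
  exact ⟨_, t, hr, ht, hQ⟩

/-! #### Frame conditions -/

/-- The program may write the integer variable `i`. -/
def Prog.writesN (i : ℕ) : Prog → Bool
  | .setN j _ => i == j
  | .seq p r => p.writesN i || r.writesN i
  | .ite _ p r => p.writesN i || r.writesN i
  | .loop _ p => p.writesN i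
  | _ => false

/-- The program may write the real variable `i`. -/
def Prog.writesR (i : ℕ) : Prog → Bool
  | .setR j _ => i == j
  | .seq p r => p.writesR i || r.writesR i
  | .ite _ p r => p.writesR i || r.writesR i
  | .loop _ p => p.writesR i
  | _ => false

/-- The program may write into the integer array `a`. -/
def Prog.writesNArr (a : ℕ) : Prog → Bool
  | .putN b _ _ => a == b
  | .seq p r => p.writesNArr a || r.writesNArr a
  | .ite _ p r => p.writesNArr a || r.writesNArr a
  | .loop _ p => p.writesNArr a
  | _ => false

/-- The program may write into the real array `a`. -/
def Prog.writesRArr (a : ℕ) : Prog → Bool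
  | .putR b _ _ => a == b
  | .seq p r => p.writesRArr a || r.writesRArr a
  | .ite _ p r => p.writesRArr a || r.writesRArr a
  | .loop _ p => p.writesRArr a
  | _ => false

/-- `s'` agrees with `s` on all memory that `p` does not write. -/
structure Frame (p : Prog) (s s' : State) : Prop where
  nvar : ∀ i, p.writesN i = false → s'.nvar i = s.nvar i
  rvar : ∀ i, p.writesR i = false → s'.rvar i = s.rvar i
  narr : ∀ a, p.writesNArr a = false → s'.narr a = s.narr a
  rarr : ∀ a, p.writesRArr a = false → s'.rarr a = s.rarr a

theorem Frame.refl (p : Prog) (s : State) : Frame p s s :=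
  ⟨fun _ _ => rfl, fun _ _ => rfl, fun _ _ => rfl, fun _ _ => rfl⟩

theorem Frame.trans {p : Prog} {s s' s'' : State} (h : Frame p s s') (h' : Frame p s' s'') :
    Frame p s s'' :=
  ⟨fun i hi => (h'.nvar i hi).trans (h.nvar i hi), fun i hi => (h'.rvar i hi).trans (h.rvar i hi),
    fun i hi => (h'.narr i hi).trans (h.narr i hi), fun i hi => (h'.rarr i hi).trans (h.rarr i hi)⟩

theorem Frame.weaken {p r : Prog} {s s' : State} (h : Frame p s s')
    (h1 : ∀ i, r.writesN i = false → p.writesN i = false)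
    (h2 : ∀ i, r.writesR i = false → p.writesR i = false)
    (h3 : ∀ i, r.writesNArr i = false → p.writesNArr i = false)
    (h4 : ∀ i, r.writesRArr i = false → p.writesRArr i = false) : Frame r s s' :=
  ⟨fun i hi => h.nvar i (h1 i hi), fun i hi => h.rvar i (h2 i hi),
    fun i hi => h.narr i (h3 i hi), fun i hi => h.rarr i (h4 i hi)⟩

/-- The memory that may change is read off the program text, so invariants need to mention only what
a loop body computes; preservation of everything else is closed by `rfl`. -/
theorem Runs.frame {p : Prog} {s s' : State} {t : ℕ} (h : Runs p s s' t) : Frame p s s' := by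
  induction h with
  | skip s => exact Frame.refl _ _
  | setN s i e =>
    exact ⟨fun j hj => Function.update_of_ne (by simpa [Prog.writesN] using hj) _ _,
      fun _ _ => rfl, fun _ _ => rfl, fun _ _ => rfl⟩
  | setR s i e =>
    exact ⟨fun _ _ => rfl, fun j hj => Function.update_of_ne (by simpa [Prog.writesR] using hj) _ _,
      fun _ _ => rfl, fun _ _ => rfl⟩
  | putN s a idx e =>
    exact ⟨fun _ _ => rfl, fun _ _ => rfl,
      fun j hj => Function.update_of_ne (by simpa [Prog.writesNArr] using hj) _ _, fun _ _ => rfl⟩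
  | putR s a idx e =>
    exact ⟨fun _ _ => rfl, fun _ _ => rfl, fun _ _ => rfl,
      fun j hj => Function.update_of_ne (by simpa [Prog.writesRArr] using hj) _ _⟩
  | seq _ _ ih1 ih2 =>
    refine (ih1.weaken ?_ ?_ ?_ ?_).trans (ih2.weaken ?_ ?_ ?_ ?_) <;>
      simp +contextual [Prog.writesN, Prog.writesR, Prog.writesNArr, Prog.writesRArr]
  | ite_true _ _ ih =>
    refine ih.weaken ?_ ?_ ?_ ?_ <;>
      simp +contextual [Prog.writesN, Prog.writesR, Prog.writesNArr, Prog.writesRArr]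
  | ite_false _ _ ih =>
    refine ih.weaken ?_ ?_ ?_ ?_ <;>
      simp +contextual [Prog.writesN, Prog.writesR, Prog.writesNArr, Prog.writesRArr]
  | loop_true _ _ _ ih1 ih2 =>
    refine (ih1.weaken ?_ ?_ ?_ ?_).trans ih2 <;>
      simp +contextual [Prog.writesN, Prog.writesR, Prog.writesNArr, Prog.writesRArr]
  | loop_false _ => exact Frame.refl _ _

theorem Halts.frame {p : Prog} {s : State} {B : ℕ} {Q : State → Prop} (h : Halts p s B Q) :
    Halts p s B (fun s' => Q s' ∧ Frame p s s') := by
  obtain ⟨s', t, hr, ht, hq⟩ := h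
  exact ⟨s', t, hr, ht, hq, hr.frame⟩

/-! #### Counting loops -/

/-- The state with integer variable `i` set to `x`. -/
def State.withN (s : State) (i x : ℕ) : State := { s with nvar := Function.update s.nvar i x }

@[simp] theorem State.withN_nvar (s : State) (i x j : ℕ) :
    (s.withN i x).nvar j = if j = i then x else s.nvar j := by
  simp [State.withN, Function.update_apply]

@[simp] theorem State.withN_rvar (s : State) (i x : ℕ) : (s.withN i x).rvar = s.rvar := rfl

@[simp] theorem State.withN_narr (s : State) (i x : ℕ) : (s.withN i x).narr = s.narr := rfl

@[simp] theorem State.withN_rarr (s : State) (i x : ℕ) : (s.withN i x).rarr = s.rarr := rfl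

/-- `for i = 0, …, n - 1` with `n` in integer variable `10`. -/
def Prog.forUp (i : ℕ) (p : Prog) : Prog :=
  .seq (.setN i (.const 0))
    (.loop (.nlt (.var i) (.var 10)) (.seq p (.setN i (.add (.var i) (.const 1)))))

/-- Each iteration costs 4 for the loop test and 4 for the increment; the remaining 6 are the
initialisation (2) and the failing test (4). The bound `c` may vary with the index, which is needed
to charge work to the degree of a node. -/
theorem Halts.forUp {i n : ℕ} {p : Prog} {s : State} {c : ℕ → ℕ} (Inv : ℕ → State → Prop)
    (hn : s.nvar 10 = n) (hi : p.writesN i = false) (h10 : p.writesN 10 = false) (hi10 : 10 ≠ i)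
    (h0 : Inv 0 (s.withN i 0))
    (hstep : ∀ j < n, ∀ s', Frame (.forUp i p) s s' → s'.nvar i = j → Inv j s' →
      Halts p s' (c j) (fun s'' => Inv (j + 1) (s''.withN i (j + 1)))) :
    Halts (.forUp i p) s ((∑ j ∈ Finset.range n, (c j + 8)) + 6)
      (fun s' => Inv n s' ∧ Frame (.forUp i p) s s') := by
  have hw10 : (Prog.forUp i p).writesN 10 = false := by
    simp [Prog.forUp, Prog.writesN, h10, hi10]
  -- Here `m` is the number of iterations still to come.
  have main : ∀ m j, j + m = n → ∀ s', Frame (.forUp i p) s s' → s'.nvar i = j → Inv j s' →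
      Halts (.loop (.nlt (.var i) (.var 10)) (.seq p (.setN i (.add (.var i) (.const 1))))) s'
        ((∑ k ∈ Finset.range m, (c (j + k) + 8)) + 4) (Inv n) := by
    intro m
    induction m with
    | zero =>
      intro j hj s' hF hij hI
      refine ⟨s', _, .loop_false ?_, ?_, ?_⟩
      · simp only [Test.Holds, NExp.eval, hij, hF.nvar 10 hw10, hn]; omega
      · simp [Test.cost, NExp.cost]
      · obtain rfl : j = n := by omega
        exact hI
    | succ m ih =>
      intro j hj s' hF hij hI
      obtain ⟨s₁, t₁, hr₁, ht₁, hI₁⟩ := hstep j (by omega) s' hF hij hI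
      have hs1i : s₁.nvar i = j := by rw [hr₁.frame.nvar i hi, hij]
      have hr2 : Runs (.setN i (.add (.var i) (.const 1))) s₁ (s₁.withN i (j + 1)) 4 := by
        have := Runs.setN s₁ i (.add (.var i) (.const 1))
        simpa [State.withN, NExp.eval, NExp.cost, hs1i] using this
      have hF2 : Frame (.forUp i p) s' (s₁.withN i (j + 1)) := by
        refine (Runs.seq hr₁ hr2).frame.weaken ?_ ?_ ?_ ?_ <;>
          simp +contextual [Prog.forUp, Prog.writesN, Prog.writesR, Prog.writesNArr,
            Prog.writesRArr]
      obtain ⟨s₃, t₃, hr₃, ht₃, hI₃⟩ := ih (j + 1) (by omega) (s₁.withN i (j + 1)) (hF.trans hF2)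
        (by simp) hI₁
      refine ⟨s₃, _, .loop_true ?_ (.seq hr₁ hr2) hr₃, ?_, hI₃⟩
      · simp only [Test.Holds, NExp.eval, hij, hF.nvar 10 hw10, hn]; omega
      · rw [Finset.sum_range_succ']
        simp only [Test.cost, NExp.cost, add_zero]
        have : ∀ k, j + 1 + k = j + (k + 1) := fun k => by omega
        simp only [this] at ht₃
        omega
  have hr0 : Runs (.setN i (.const 0)) s (s.withN i 0) 2 := Runs.setN s i (.const 0)
  have hF0 : Frame (.forUp i p) s (s.withN i 0) := by
    refine hr0.frame.weaken ?_ ?_ ?_ ?_ <;>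
      simp +contextual [Prog.forUp, Prog.writesN, Prog.writesR, Prog.writesNArr, Prog.writesRArr]
  obtain ⟨s', t, hr, ht, hI⟩ := main n 0 (by omega) _ hF0 (by simp) h0
  refine (Halts.frame (Q := Inv n) ⟨s', _, .seq hr0 hr, ?_, hI⟩)
  simp only [zero_add] at ht
  omega

/-! ### Hitting probabilities on a tree -/

section Tree

variable {V : Type*} {G : SimpleGraph V}

theorem exists_adj_dist_succ (hG : G.Connected) {v w : V} (h : w ≠ v) :
    ∃ p, G.Adj w p ∧ G.dist v w = G.dist v p + 1 := by
  obtain ⟨W, hW⟩ := hG.exists_walk_length_eq_dist w v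
  cases W with
  | nil => exact absurd rfl h
  | @cons _ p _ ha W' =>
    refine ⟨p, ha, ?_⟩
    have h1 : G.dist p v ≤ W'.length := SimpleGraph.dist_le W'
    have h2 := hG.dist_triangle (u := w) (v := p) (w := v)
    rw [SimpleGraph.dist_eq_one_iff_adj.2 ha] at h2
    rw [SimpleGraph.Walk.length_cons] at hW
    rw [SimpleGraph.dist_comm (u := v), SimpleGraph.dist_comm (u := v)]
    omega

/-- Both edges extend to shortest paths from `w` to `v`, and a tree has only one path between two
nodes. -/
theorem eq_of_adj_dist_succ (hG : G.IsTree) {v w p p' : V} (h : G.Adj w p) (h' : G.Adj w p')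
    (hd : G.dist v w = G.dist v p + 1) (hd' : G.dist v w = G.dist v p' + 1) : p = p' := by
  obtain ⟨W, hW⟩ := hG.connected.exists_walk_length_eq_dist p v
  obtain ⟨W', hW'⟩ := hG.connected.exists_walk_length_eq_dist p' v
  have h1 : (SimpleGraph.Walk.cons h W).IsPath := by
    apply SimpleGraph.Walk.isPath_of_length_eq_dist
    rw [SimpleGraph.Walk.length_cons, hW, SimpleGraph.dist_comm (u := w), hd,
      SimpleGraph.dist_comm (u := v)]
  have h2 : (SimpleGraph.Walk.cons h' W').IsPath := by
    apply SimpleGraph.Walk.isPath_of_length_eq_dist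
    rw [SimpleGraph.Walk.length_cons, hW', SimpleGraph.dist_comm (u := w), hd',
      SimpleGraph.dist_comm (u := v)]
  have := (hG.existsUnique_path w v).unique h1 h2
  injection this

variable [Fintype V]

open Classical in
/-- The number of nodes that a walk along the dart `p → w` can still lead to. -/
noncomputable def sideCard (G : SimpleGraph V) (w p : V) : ℕ :=
  (Finset.univ.filter fun x => G.dist x p = G.dist x w + 1).card

theorem sideCard_le (G : SimpleGraph V) (w p : V) : sideCard G w p ≤ Fintype.card V :=
  Finset.card_le_univ _

theorem sideCard_pos {w p : V} (h : G.Adj w p) : 0 < sideCard G w p := by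
  classical
  refine Finset.card_pos.2 ⟨w, ?_⟩
  simp [SimpleGraph.dist_eq_one_iff_adj.2 h]

/-- A node behind `c` as seen from `w` is behind `w` as seen from `p`, for otherwise `w` would have
two neighbours nearer to it; `w` itself makes the inclusion strict. So the recursion for the ratios
is well-founded. -/
theorem sideCard_lt (hG : G.IsTree) {w p c : V} (hp : G.Adj w p) (hc : G.Adj w c) (hcp : c ≠ p) :
    sideCard G c w < sideCard G w p := by
  classical
  refine Finset.card_lt_card ⟨?_, ?_⟩
  · intro x hx
    simp only [Finset.mem_filter, Finset.mem_univ, true_and] at hx ⊢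
    rcases hG.dist_eq_dist_add_one_of_adj x hp with h | h
    · exact absurd (eq_of_adj_dist_succ hG hc hp hx h) hcp
    · exact h
  · intro hsub
    have : w ∈ Finset.univ.filter fun x => G.dist x p = G.dist x w + 1 := by
      simp [SimpleGraph.dist_eq_one_iff_adj.2 hp]
    have := hsub this
    simp [SimpleGraph.dist_eq_one_iff_adj.2 hc] at this

open Classical in
/-- The value that the probability to traverse the dart `w → p` before the next jump must have in
terms of the probabilities of the darts `c → w`. -/
noncomputable def ratioStep (G : SimpleGraph V) (α : ℝ) (r : V → V → ℝ) (w p : V) : ℝ :=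
  (1 - α) / (1 + ∑ c, if G.Adj w c ∧ c ≠ p then 1 - (1 - α) * r c w else 0)

/-- `r w p` is, for every edge `wp`, the probability that the walk from `w` reaches `p` before the
next jump. -/
def IsRatio (G : SimpleGraph V) (α : ℝ) (r : V → V → ℝ) : Prop :=
  ∀ w p, G.Adj w p → r w p = ratioStep G α r w p

/-- By induction along `sideCard` every summand of the denominator is nonnegative, so the
denominator is at least 1 while the numerator lies strictly between 0 and 1. -/
theorem IsRatio.mem_Ioo {α : ℝ} {r : V → V → ℝ} (hr : IsRatio G α r) (hG : G.IsTree)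
    (h0 : 0 < α) (h1 : α < 1) {w p : V} (h : G.Adj w p) : 0 < r w p ∧ r w p < 1 := by
  classical
  induction hm : sideCard G w p using Nat.strong_induction_on generalizing w p with
  | _ m ih =>
    have hs : 0 ≤ ∑ c, if G.Adj w c ∧ c ≠ p then 1 - (1 - α) * r c w else 0 := by
      refine Finset.sum_nonneg fun c _ => ?_
      split_ifs with hc
      · obtain ⟨h3, h4⟩ := ih _ (hm ▸ sideCard_lt hG h hc.1 hc.2) hc.1.symm rfl
        nlinarith
      · exact le_rfl
    rw [hr w p h, ratioStep]
    constructor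
    · exact div_pos (by linarith) (by linarith)
    · rw [div_lt_one (by linarith)]; linarith

/-- `φ w` is the probability that the walk from `w` reaches `v` before the next jump, and `b w` is
the neighbour of `v` on the way from `w` to `v`. -/
structure IsHitTable (G : SimpleGraph V) (r : V → V → ℝ) (v : V) (φ : V → ℝ) (b : V → V) :
    Prop where
  self : φ v = 1
  mul : ∀ w p, G.Adj w p → G.dist v w = G.dist v p + 1 → φ w = r w p * φ p
  adj : ∀ w, G.Adj w v → b w = w
  branch : ∀ w p, G.Adj w p → G.dist v w = G.dist v p + 1 → p ≠ v → b w = b p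

namespace IsHitTable

variable {α : ℝ} {r : V → V → ℝ} {v : V} {φ : V → ℝ} {b : V → V}

omit [Fintype V] in
theorem branch_eq (hT : IsHitTable G r v φ b) (hG : G.IsTree) {w u : V} (h : G.Adj w u)
    (hw : w ≠ v) (hu : u ≠ v) : b w = b u := by
  rcases hG.dist_eq_dist_add_one_of_adj v h with hd | hd
  · exact hT.branch w u h hd hu
  · exact (hT.branch u w h.symm hd hw).symm

/-- Each further edge of the path multiplies `φ` by a ratio below 1. The strict decrease beyond `b
w` is what later forces an optimal set to contain `b w` along with `w`. -/
theorem bounds (hT : IsHitTable G r v φ b) (hr : IsRatio G α r) (hG : G.IsTree)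
    (h0 : 0 < α) (h1 : α < 1) (w : V) :
    0 < φ w ∧ φ w ≤ 1 ∧ (w ≠ v → φ w < 1 ∧ G.Adj v (b w) ∧ φ w ≤ φ (b w) ∧
      (w ≠ b w → φ w < φ (b w))) := by
  induction hm : G.dist v w using Nat.strong_induction_on generalizing w with
  | _ m ih =>
    by_cases hwv : w = v
    · subst hwv; simp [hT.self]
    obtain ⟨p, hp, hd⟩ := exists_adj_dist_succ hG.connected hwv
    obtain ⟨i1, i2, i3⟩ := ih (G.dist v p) (by omega) p rfl
    obtain ⟨r0, r1⟩ := hr.mem_Ioo hG h0 h1 hp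
    have e := hT.mul w p hp hd
    have l : φ w < φ p := by rw [e]; nlinarith
    refine ⟨by rw [e]; positivity, by linarith, fun _ => ⟨by linarith, ?_⟩⟩
    by_cases hpv : p = v
    · subst hpv
      rw [hT.adj w hp]
      exact ⟨hp.symm, le_rfl, fun h => absurd rfl h⟩
    · obtain ⟨-, j1, j2, -⟩ := i3 hpv
      rw [hT.branch w p hp hd hpv]
      exact ⟨j1, by linarith, fun _ => by linarith⟩

open Classical in
-- This is the recursion for the ratio of `w` towards its parent `p`, multiplied out: every other
-- neighbour `u` lies farther from `v`, so `φ u = r u w * φ w`.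
theorem harmonic (hT : IsHitTable G r v φ b) (hr : IsRatio G α r) (hG : G.IsTree)
    (h0 : 0 < α) (h1 : α < 1) {w : V} (hw : w ≠ v) :
    (∑ u, if G.Adj w u then (1 : ℝ) else 0) * φ w
      = (1 - α) * ∑ u, if G.Adj w u then φ u else 0 := by
  obtain ⟨p, hp, hd⟩ := exists_adj_dist_succ hG.connected hw
  have e := hT.mul w p hp hd
  have hs : 0 ≤ ∑ c, if G.Adj w c ∧ c ≠ p then 1 - (1 - α) * r c w else 0 := by
    refine Finset.sum_nonneg fun c _ => ?_
    split_ifs with hc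
    · obtain ⟨h3, h4⟩ := hr.mem_Ioo hG h0 h1 hc.1.symm
      nlinarith
    · exact le_rfl
  have hrw := hr w p hp
  rw [ratioStep, eq_div_iff (by linarith)] at hrw
  -- The parent contributes the leading 1 of the denominator, the other neighbours contribute the
  -- sum.
  have key : ∑ u, ((if G.Adj w u then (1 : ℝ) else 0) * φ w - (1 - α) * if G.Adj w u then φ u else 0)
      = (∑ u, (if G.Adj w u ∧ u ≠ p then 1 - (1 - α) * r u w else 0) * φ w)
        + ∑ u, if u = p then φ w - (1 - α) * φ p else 0 := by
    rw [← Finset.sum_add_distrib]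
    refine Finset.sum_congr rfl fun u _ => ?_
    by_cases hu : G.Adj w u
    · by_cases hup : u = p
      · subst hup; simp [hu]
      · have : φ u = r u w * φ w := by
          refine hT.mul u w hu.symm ?_
          rcases hG.dist_eq_dist_add_one_of_adj v hu with h | h
          · exact absurd (eq_of_adj_dist_succ hG hu hp h hd) hup
          · exact h
        simp [hu, hup, this]; ring
    · have : u ≠ p := fun h => hu (h ▸ hp)
      simp [hu, this]
  rw [Finset.sum_ite_eq' Finset.univ p, Finset.sum_sub_distrib, ← Finset.sum_mul,
    ← Finset.mul_sum, ← Finset.sum_mul] at key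
  simp only [Finset.mem_univ, if_true] at key
  have : (1 - α) * φ p = r w p * φ p * (1 + ∑ c, if G.Adj w c ∧ c ≠ p then 1 - (1 - α) * r c w else 0) := by
    rw [mul_right_comm, hrw]
  rw [← e] at this
  linarith

end IsHitTable

end Tree

/-! ### PageRank from hitting probabilities -/

section Value

variable {V : Type*} [Fintype V]

open Classical in
-- `ψ w` is the expected number of visits to `v` from `w` before the next jump. Evaluating `∑ π ψ`
-- once by the equation for `ψ` and once by stationarity of `π` leaves a common term that cancels.
theorem pageRank_eq_sum (D : Digraph V) {α : ℝ} (h0 : 0 < α) (h1 : α < 1) {q : V → ℝ}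
    (hq : q ∈ stdSimplex ℝ V) (v : V) (ψ : V → ℝ)
    (hψ : ∀ w, ψ w = (if w = v then 1 else 0) + (1 - α) * ∑ u, linkStep D w u * ψ u) :
    pageRank D α q v = α * ∑ w, q w * ψ w := by
  obtain ⟨⟨hnn, hsum⟩, hfix⟩ := isPageRank_pageRank D h0 h1 hq
  set π := pageRank D α q
  have e1 : ∑ w, π w * ψ w = π v + (1 - α) * ∑ w, π w * ∑ u, linkStep D w u * ψ u := by
    have : ∀ w, π w * ψ w = (if w = v then π w else 0)
        + (1 - α) * (π w * ∑ u, linkStep D w u * ψ u) := by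
      intro w
      conv_lhs => rw [hψ w]
      split_ifs <;> ring
    simp_rw [this]
    rw [Finset.sum_add_distrib, ← Finset.mul_sum]
    simp
  have e2 : ∑ u, π u * ψ u = α * ∑ u, q u * ψ u
      + (1 - α) * ∑ w, π w * ∑ u, linkStep D w u * ψ u := by
    have h : ∀ u, π u * ψ u = α * (q u * ψ u) + (1 - α) * ∑ w, π w * (linkStep D w u * ψ u) := by
      intro u
      conv_lhs => rw [← hfix u]
      have : ∀ w, π w * walkStep D α q w u = π w * (α * q u) + (1 - α) * (π w * linkStep D w u) := by
        intro w; unfold walkStep; ring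
      simp_rw [this]
      rw [Finset.sum_add_distrib, ← Finset.sum_mul, hsum, ← Finset.mul_sum, add_mul, one_mul,
        mul_assoc, mul_assoc, Finset.sum_mul]
      simp only [mul_assoc]
    simp_rw [h]
    rw [Finset.sum_add_distrib, ← Finset.mul_sum, ← Finset.mul_sum, Finset.sum_comm]
    simp_rw [← Finset.mul_sum]
  linarith

open Classical in
-- Stated without division so that it also holds at a node without outlinks, where both sides
-- vanish.
theorem linkStep_average (D : Digraph V) (w : V) (f : V → ℝ) :
    (∑ u, if D.Adj w u then (1 : ℝ) else 0) * ∑ u, linkStep D w u * f u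
      = ∑ u, if D.Adj w u then f u else 0 := by
  have hc : (∑ u, if D.Adj w u then (1 : ℝ) else 0) = ((outNbrs D w).card : ℝ) := by
    rw [Finset.sum_boole]; rfl
  rw [hc, Finset.mul_sum]
  refine Finset.sum_congr rfl fun u _ => ?_
  by_cases h : (outNbrs D w).card = 0
  · have hu : ¬ D.Adj w u := by
      intro hu
      have : u ∈ outNbrs D w := by simp [outNbrs, hu]
      rw [Finset.card_eq_zero.1 h] at this
      simp at this
    simp [h, hu]
  · have h' : ((outNbrs D w).card : ℝ) ≠ 0 := by exact_mod_cast h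
    rw [linkStep, if_neg h]
    split_ifs
    · field_simp
    · ring

omit [Fintype V] in
-- Not deviating is an instance of `play`, so one PageRank formula serves both sides of the
-- comparison.
theorem bidirected_eq_play (G : SimpleGraph V) (v : V) :
    bidirected G = play G v (G.neighborSet v) ∅ := by
  ext a b
  simp only [bidirected, play, SimpleGraph.mem_neighborSet, Set.mem_empty_iff_false, or_false]
  constructor
  · intro h
    by_cases ha : a = v
    · exact .inl ⟨ha, ha ▸ h⟩
    · exact .inr ⟨ha, h, fun hb => hb ▸ h.symm⟩
  · rintro (⟨rfl, h⟩ | ⟨-, h, -⟩) <;> exact h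

open Classical in
/-- Hitting probabilities of `v` after the branches outside `E` have been cut off. -/
noncomputable def cutHit (v : V) (φ : V → ℝ) (b : V → V) (E : Set V) (w : V) : ℝ :=
  if w = v ∨ b w ∈ E then φ w else 0

open Classical in
-- Cutting an edge at `v` makes `v` unreachable from that branch and does not affect the other
-- branches, since in a tree they meet only at `v`. Thus `cutHit` gives the new hitting
-- probabilities, and only the returns of the walk started at `v` remain to be summed.
theorem pageRank_play {G : SimpleGraph V} (hG : G.IsTree) {α : ℝ} (h0 : 0 < α) (h1 : α < 1)
    {q : V → ℝ} (hq : q ∈ stdSimplex ℝ V) {r : V → V → ℝ} (hr : IsRatio G α r) {v : V}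
    {φ : V → ℝ} {b : V → V} (hT : IsHitTable G r v φ b) {E F : Set V} (hS : IsStrategy G v E F) :
    0 < (∑ w, if w ∈ E ∪ F then 1 - (1 - α) * cutHit v φ b E w else 0) ∧
    pageRank (play G v E F) α q v
      * (∑ w, if w ∈ E ∪ F then 1 - (1 - α) * cutHit v φ b E w else 0)
      = α * ((∑ w, if w ∈ E ∪ F then (1 : ℝ) else 0) * ∑ w, q w * cutHit v φ b E w) := by
  have hφ := hT.bounds hr hG h0 h1
  set f := cutHit v φ b E with hf
  have hfv : f v = 1 := by simp [hf, cutHit, hT.self]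
  have hf01 : ∀ w, 0 ≤ f w ∧ f w ≤ 1 := by
    intro w
    rw [hf, cutHit]
    split_ifs
    · exact ⟨(hφ w).1.le, (hφ w).2.1⟩
    · exact ⟨le_rfl, zero_le_one⟩
  have hv : ∀ u, (play G v E F).Adj v u ↔ u ∈ E ∪ F := by
    intro u; simp [play]
  have hw : ∀ w, w ≠ v → ∀ u, (play G v E F).Adj w u ↔ G.Adj w u ∧ (u = v → w ∈ E) := by
    intro w hwv u; simp [play, hwv]
  set Y := ∑ w, if w ∈ E ∪ F then 1 - (1 - α) * f w else 0 with hY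
  set k := ∑ w, if w ∈ E ∪ F then (1 : ℝ) else 0 with hk
  set S := ∑ w, if w ∈ E ∪ F then f w else 0 with hSdef
  have hYk : Y = k - (1 - α) * S := by
    rw [hY, hk, hSdef, Finset.mul_sum, ← Finset.sum_sub_distrib]
    exact Finset.sum_congr rfl fun w _ => by split_ifs <;> ring
  have hYpos : 0 < Y := by
    obtain ⟨x, hx⟩ := hS.nonempty
    refine Finset.sum_pos' (fun w _ => ?_) ⟨x, Finset.mem_univ x, ?_⟩
    · split_ifs
      · nlinarith [hf01 w]
      · exact le_rfl
    · rw [if_pos hx]; nlinarith [hf01 x]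
  refine ⟨hYpos, ?_⟩
  -- From `v` the walk returns with probability `(1 - α) S / k`, so the expected number of visits is
  -- `1 / (1 - (1 - α) S / k) = k / Y`; from `w` it is this number times `f w`.
  have hψ : ∀ w, k / Y * f w = (if w = v then 1 else 0)
      + (1 - α) * ∑ u, linkStep (play G v E F) w u * (k / Y * f u) := by
    intro w
    have e : ∑ u, linkStep (play G v E F) w u * (k / Y * f u)
        = k / Y * ∑ u, linkStep (play G v E F) w u * f u := by
      rw [Finset.mul_sum]; exact Finset.sum_congr rfl fun u _ => by ring
    rw [e]
    have av := linkStep_average (play G v E F) w f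
    by_cases hwv : w = v
    · subst hwv
      simp only [hv] at av
      have hkpos : 0 < k := by
        obtain ⟨x, hx⟩ := hS.nonempty
        refine Finset.sum_pos' (fun w _ => ?_) ⟨x, Finset.mem_univ x, ?_⟩
        · split_ifs <;> norm_num
        · rw [if_pos hx]; norm_num
      rw [← hk, ← hSdef] at av
      rw [hfv, if_pos rfl]
      have : ∑ u, linkStep (play G w E F) w u * f u = S / k := by
        rw [eq_div_iff hkpos.ne', mul_comm]; exact av
      rw [this]
      field_simp
      linarith
    · rw [if_neg hwv, zero_add]
      have hmain : f w = (1 - α) * ∑ u, linkStep (play G v E F) w u * f u := by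
        by_cases hbE : b w ∈ E
        · have hsame : ∀ u, (play G v E F).Adj w u ↔ G.Adj w u := by
            intro u
            rw [hw w hwv]
            refine ⟨fun h => h.1, fun h => ⟨h, ?_⟩⟩
            rintro rfl
            rwa [hT.adj w h] at hbE
          have hfe : ∀ u, G.Adj w u → f u = φ u := by
            intro u hu
            rw [hf, cutHit, if_pos]
            by_cases huv : u = v
            · exact .inl huv
            · rw [← hT.branch_eq hG hu hwv huv]; exact .inr hbE
          have hdeg : 0 < ∑ u, if G.Adj w u then (1 : ℝ) else 0 := by
            obtain ⟨x, hx, -⟩ := exists_adj_dist_succ hG.connected hwv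
            refine Finset.sum_pos' (fun w _ => ?_) ⟨x, Finset.mem_univ x, ?_⟩
            · split_ifs <;> norm_num
            · rw [if_pos hx]; norm_num
          have har := hT.harmonic hr hG h0 h1 hwv
          simp only [hsame] at av
          have : (∑ u, if G.Adj w u then f u else 0) = ∑ u, if G.Adj w u then φ u else 0 :=
            Finset.sum_congr rfl fun u _ => by split_ifs with h <;> simp [hfe, h]
          rw [this] at av
          rw [← av] at har
          have hfw : f w = φ w := by rw [hf, cutHit, if_pos (.inr hbE)]
          rw [hfw]
          apply mul_left_cancel₀ hdeg.ne'
          rw [har]; ring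
        · have hfw : f w = 0 := by rw [hf, cutHit, if_neg (by tauto)]
          have hfu : ∀ u, linkStep (play G v E F) w u * f u = 0 := by
            intro u
            by_cases hu : (play G v E F).Adj w u
            · rw [hw w hwv] at hu
              have huv : u ≠ v := by
                rintro rfl
                exact hbE (by rw [hT.adj w hu.1]; exact hu.2 rfl)
              have : f u = 0 := by
                rw [hf, cutHit, if_neg]
                rw [← hT.branch_eq hG hu.1 hwv huv]; tauto
              rw [this, mul_zero]
            -- A leaf cut off from `v` has no outlinks and its walk stays put; this self-transition
            -- carries the value `f w = 0`.
            · by_cases huw : u = w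
              · rw [huw, hfw, mul_zero]
              · simp [linkStep, hu, huw]
          simp [hfw, hfu]
      conv_lhs => rw [hmain]
      ring
  rw [pageRank_eq_sum _ h0 h1 hq v _ hψ]
  have : ∑ w, q w * (k / Y * f w) = k / Y * ∑ w, q w * f w := by
    rw [Finset.mul_sum]; exact Finset.sum_congr rfl fun u _ => by ring
  rw [this]
  field_simp

end Value

/-! ### Choosing the best strategy of a given size -/

section Selection

/-- Exchange argument: `t \ s` and `s \ t` have equal size, and under any bijection each element is
replaced by one at least as large. -/
theorem sum_le_sum_of_card_le {ι : Type*} [DecidableEq ι] {s t : Finset ι} {f : ι → ℝ}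
    (hc : t.card = s.card) (h : ∀ a ∈ s, ∀ b ∈ t, b ∉ s → f b ≤ f a) :
    ∑ i ∈ t, f i ≤ ∑ i ∈ s, f i := by
  have h1 : (t \ s).card = (s \ t).card := by
    have := Finset.card_sdiff_add_card_inter t s
    have := Finset.card_sdiff_add_card_inter s t
    rw [Finset.inter_comm] at this
    omega
  have h2 : ∑ i ∈ t \ s, f i ≤ ∑ i ∈ s \ t, f i := by
    let e := Finset.equivOfCardEq h1
    rw [← Finset.sum_coe_sort, ← Finset.sum_coe_sort (s \ t), ← Equiv.sum_comp e]
    refine Finset.sum_le_sum fun i _ => ?_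
    have hi := Finset.mem_sdiff.1 i.2
    have hj := Finset.mem_sdiff.1 (e i).2
    exact h _ hj.1 _ hi.1 hi.2
  have h3 := Finset.sum_inter_add_sum_sdiff t s f
  have h4 := Finset.sum_inter_add_sum_sdiff s t f
  rw [Finset.inter_comm] at h4
  linarith

/-- The number of elements of `s` that precede `x`. -/
def rankIn {ι : Type*} (lt : ι → ι → Prop) [DecidableRel lt] (s : Finset ι) (x : ι) : ℕ :=
  (s.filter fun y => lt y x).card

variable {ι : Type*} {lt : ι → ι → Prop} [DecidableRel lt] [IsStrictTotalOrder ι lt]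
  {s : Finset ι}

theorem rankIn_lt_rankIn {x y : ι} (hx : x ∈ s) (h : lt x y) : rankIn lt s x < rankIn lt s y := by
  refine Finset.card_lt_card ⟨fun z hz => ?_, fun hsub => ?_⟩
  · simp only [Finset.mem_filter] at hz ⊢
    exact ⟨hz.1, trans_of lt hz.2 h⟩
  · have := hsub (Finset.mem_filter.2 ⟨hx, h⟩)
    exact irrefl_of lt x (Finset.mem_filter.1 this).2

theorem lt_of_rankIn_lt_rankIn {x y : ι} (hy : y ∈ s) (h : rankIn lt s x < rankIn lt s y) :
    lt x y := by
  rcases trichotomous_of lt x y with h1 | rfl | h1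
  · exact h1
  · omega
  · have := rankIn_lt_rankIn hy h1; omega

/-- In a strict total order the ranks are a bijection from `s` onto the first `s.card` numbers. -/
theorem card_filter_rankIn_lt [DecidableEq ι] {k : ℕ} (hk : k ≤ s.card) :
    (s.filter fun x => rankIn lt s x < k).card = k := by
  have hinj : Set.InjOn (rankIn lt s) s := by
    intro x hx y hy hxy
    rcases trichotomous_of lt x y with h1 | h1 | h1
    · have := rankIn_lt_rankIn hx h1; omega
    · exact h1
    · have := rankIn_lt_rankIn hy h1; omega
  have himg : s.image (rankIn lt s) = Finset.range s.card := by
    apply Finset.eq_of_subset_of_card_le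
    · intro m hm
      obtain ⟨x, hx, rfl⟩ := Finset.mem_image.1 hm
      rw [Finset.mem_range]
      refine Finset.card_lt_card ⟨Finset.filter_subset _ _, fun hsub => ?_⟩
      exact irrefl_of lt x (Finset.mem_filter.1 (hsub hx)).2
    · rw [Finset.card_image_of_injOn hinj, Finset.card_range]
  rw [← Finset.card_image_of_injOn (hinj.mono (Finset.filter_subset _ _))]
  have : (s.filter fun x => rankIn lt s x < k).image (rankIn lt s) = Finset.range k := by
    ext m
    simp only [Finset.mem_image, Finset.mem_filter, Finset.mem_range]
    constructor
    · rintro ⟨x, ⟨-, h⟩, rfl⟩; exact h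
    · intro hm
      have : m ∈ s.image (rankIn lt s) := by rw [himg, Finset.mem_range]; omega
      obtain ⟨x, hx, rfl⟩ := Finset.mem_image.1 this
      exact ⟨x, ⟨hx, hm⟩, rfl⟩
  rw [this, Finset.card_range]

theorem sum_le_sum_filter_rankIn_lt [DecidableEq ι] {t : Finset ι} {f : ι → ℝ} (ht : t ⊆ s)
    (hf : ∀ x y, lt x y → f y ≤ f x) :
    ∑ i ∈ t, f i ≤ ∑ i ∈ s.filter (fun x => rankIn lt s x < t.card), f i := by
  refine sum_le_sum_of_card_le
    (card_filter_rankIn_lt (Finset.card_le_card ht)).symm fun a ha b hb hbs => ?_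
  rw [Finset.mem_filter] at ha hbs
  have : ¬ rankIn lt s b < t.card := fun h => hbs ⟨ht hb, h⟩
  exact hf _ _ (lt_of_rankIn_lt_rankIn (ht hb) (by omega))

end Selection

/-- `x` precedes `y` in the order by decreasing weight, ties being broken by the index. -/
def Beats {ι : Type*} [LinearOrder ι] (f : ι → ℝ) (x y : ι) : Prop :=
  if x < y then ¬ f x < f y else f y < f x

theorem Beats.le {ι : Type*} [LinearOrder ι] {f : ι → ℝ} {x y : ι} (h : Beats f x y) :
    f y ≤ f x := by
  unfold Beats at h
  split_ifs at h
  · exact not_lt.1 h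
  · exact h.le

theorem beats_of_lt {ι : Type*} [LinearOrder ι] {f : ι → ℝ} {x y : ι} (h : f y < f x) :
    Beats f x y := by
  unfold Beats
  split_ifs
  · exact h.not_gt
  · exact h

instance Beats.isStrictTotalOrder {ι : Type*} [LinearOrder ι] (f : ι → ℝ) :
    IsStrictTotalOrder ι (Beats f) where
  trichotomous x y h1 h2 := by
    unfold Beats at h1 h2
    rcases lt_trichotomy x y with h | h | h
    · simp only [h, h.not_gt, if_true, if_false] at h1 h2; tauto
    · exact h
    · simp only [h, h.not_gt, if_true, if_false] at h1 h2; tauto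
  irrefl x := by simp [Beats]
  trans x y z h1 h2 := by
    unfold Beats at *
    split_ifs at h1 h2 ⊢ with a b c c b c c <;> first | linarith | skip
    all_goals (exfalso; order)

/-! ### Improving strategies of a player in a tree -/

section Improving

variable {V : Type*} [Fintype V] [DecidableEq V]

/-- The discounted probability mass that reaches `v` through the neighbour `u`. -/
def inflow (q : V → ℝ) (v : V) (φ : V → ℝ) (b : V → V) (u : V) : ℝ :=
  ∑ w, if w ≠ v ∧ b w = u then q w * φ w else 0

open Classical in
/-- The PageRank of `v` in the bidirected tree, divided by `α`. -/
noncomputable def baseValue (G : SimpleGraph V) (α : ℝ) (q : V → ℝ) (v : V) (φ : V → ℝ) : ℝ :=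
  (∑ w, q w * φ w) * (∑ u, if G.Adj v u then (1 : ℝ) else 0)
    / ∑ u, if G.Adj v u then 1 - (1 - α) * φ u else 0

/-- The contribution of an outlink to `w` to the surplus of a strategy with `k` outlinks. -/
noncomputable def weight (G : SimpleGraph V) (α : ℝ) (q : V → ℝ) (v : V) (φ : V → ℝ) (b : V → V)
    (k : ℕ) (w : V) : ℝ :=
  baseValue G α q v φ * (1 - α) * φ w - (baseValue G α q v φ - q v) + k * inflow q v φ b w

variable {G : SimpleGraph V} {α : ℝ} {q : V → ℝ} {r : V → V → ℝ} {v : V} {φ : V → ℝ} {b : V → V}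

open Classical in
-- Clearing the positive denominator in `pageRank_play` turns the comparison into `k M > c Y`. Both
-- sides are distributed over the outlinks of the strategy. Positivity of `baseValue` is included
-- because it needs a strategy to exist, which excludes the one-node tree.
theorem isImproving_iff (hG : G.IsTree) (h0 : 0 < α) (h1 : α < 1) (hq : q ∈ stdSimplex ℝ V)
    (hr : IsRatio G α r) (hT : IsHitTable G r v φ b) {E F : Set V} (hS : IsStrategy G v E F) :
    0 < baseValue G α q v φ ∧ (IsImproving G α q v E F ↔
      0 < ∑ w, if w ∈ E ∪ F then
        baseValue G α q v φ * (1 - α) * cutHit v φ b E w - (baseValue G α q v φ - q v)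
          + (Finset.univ.filter (· ∈ E ∪ F)).card * (if w ∈ E then inflow q v φ b w else 0)
        else 0) := by
  have hφ := hT.bounds hr hG h0 h1
  obtain ⟨x, hx⟩ := hS.nonempty
  have hxv : x ≠ v := by
    rcases hx with h | h
    · rintro rfl; exact G.loopless.irrefl _ (hS.retained x h)
    · exact (hS.requested x h).2
  -- Keeping all edges is a legal strategy, because a target of `(E, F)` other than `v` is reached
  -- through some neighbour of `v`.
  have hN : IsStrategy G v (G.neighborSet v) ∅ :=
    ⟨fun u hu => hu, fun u hu => hu.elim, ⟨b x, .inl ((hφ x).2.2 hxv).2.1⟩⟩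
  obtain ⟨hY, e1⟩ := pageRank_play hG h0 h1 hq hr hT hN
  obtain ⟨hY', e2⟩ := pageRank_play hG h0 h1 hq hr hT hS
  rw [← bidirected_eq_play] at e1
  have hcut : ∀ w, cutHit v φ b (G.neighborSet v) w = φ w := by
    intro w
    rw [cutHit, if_pos]
    by_cases h : w = v
    · exact .inl h
    · exact .inr ((hφ w).2.2 h).2.1
  simp only [hcut, Set.union_empty, SimpleGraph.mem_neighborSet] at hY e1
  have hb : pageRank (bidirected G) α q v = α * baseValue G α q v φ := by
    rw [baseValue, ← mul_div_assoc, eq_div_iff hY.ne', e1]; ring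
  have hc : 0 < baseValue G α q v φ := by
    refine div_pos (mul_pos ?_ ?_) hY
    · obtain ⟨y, -, hy⟩ : ∃ y ∈ Finset.univ, 0 < q y := by
        by_contra! h
        have := Finset.sum_nonpos h
        rw [hq.2] at this
        linarith
      exact Finset.sum_pos' (fun w _ => mul_nonneg (hq.1 w) (hφ w).1.le)
        ⟨y, Finset.mem_univ y, mul_pos hy (hφ y).1⟩
    · refine Finset.sum_pos' (fun w _ => ?_) ⟨b x, Finset.mem_univ _, ?_⟩
      · split_ifs <;> norm_num
      · rw [if_pos ((hφ x).2.2 hxv).2.1]; norm_num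
  refine ⟨hc, ?_⟩
  rw [IsImproving, and_iff_right hS, hb]
  set c := baseValue G α q v φ
  have hcard : (∑ w, if w ∈ E ∪ F then (1 : ℝ) else 0)
      = ((Finset.univ.filter (· ∈ E ∪ F)).card : ℝ) := by
    rw [Finset.sum_boole]
  rw [hcard] at e2
  set k := ((Finset.univ.filter (· ∈ E ∪ F)).card : ℝ) with hk
  set Y := ∑ w, if w ∈ E ∪ F then 1 - (1 - α) * cutHit v φ b E w else 0 with hYdef
  -- The mass that still reaches `v` is sorted by the branch from which it comes.
  have hmass : ∑ w, q w * cutHit v φ b E w = q v + ∑ w, if w ∈ E then inflow q v φ b w else 0 := by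
    have : ∀ u, (if u ∈ E then inflow q v φ b u else 0)
        = ∑ w, if b w = u then (if w ≠ v ∧ b w ∈ E then q w * φ w else 0) else 0 := by
      intro u
      rw [inflow]
      split_ifs with h
      · refine Finset.sum_congr rfl fun w _ => ?_
        by_cases hbw : b w = u
        · subst hbw; simp [h]
        · simp [hbw]
      · symm
        refine Finset.sum_eq_zero fun w _ => ?_
        split_ifs with h1 h2
        · subst h1; exact absurd h2.2 h
        · rfl
        · rfl
    simp_rw [this]
    rw [Finset.sum_comm]
    simp only [Finset.sum_ite_eq, Finset.mem_univ, if_true]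
    have : q v = ∑ w, if w = v then q w * φ w else 0 := by
      simp [hT.self]
    rw [this, ← Finset.sum_add_distrib]
    refine Finset.sum_congr rfl fun w _ => ?_
    rw [cutHit]
    by_cases h : w = v
    · simp [h]
    · by_cases h' : b w ∈ E <;> simp [h, h']
  -- The term `k * q v` is spread as one `q v` per outlink, and `k` times the inflow of a neighbour
  -- is charged to the link to that neighbour.
  have hexp : (∑ w, if w ∈ E ∪ F then c * (1 - α) * cutHit v φ b E w - (c - q v)
      + k * (if w ∈ E then inflow q v φ b w else 0) else 0)
      = k * ∑ w, q w * cutHit v φ b E w - c * Y := by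
    rw [hmass, mul_add, hYdef, Finset.mul_sum, Finset.mul_sum, ← hcard, Finset.sum_mul, hcard,
      ← Finset.sum_add_distrib, ← Finset.sum_sub_distrib]
    refine Finset.sum_congr rfl fun w _ => ?_
    by_cases hw : w ∈ E
    · simp [hw]; ring
    · by_cases hw' : w ∈ F <;> simp [hw, hw'] ; ring
  rw [hexp, sub_pos, ← mul_lt_mul_iff_left₀ hY', e2, mul_assoc, mul_lt_mul_iff_right₀ h0]

theorem inflow_nonneg (hq : q ∈ stdSimplex ℝ V) (hφ : ∀ w, 0 < φ w) (u : V) :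
    0 ≤ inflow q v φ b u :=
  Finset.sum_nonneg fun w _ => by
    split_ifs
    · exact mul_nonneg (hq.1 w) (hφ w).le
    · exact le_rfl

/-- Consequently the weight of a non-neighbour does not depend on the number of outlinks, which is
the key to the running time. -/
theorem inflow_eq_zero (hb : ∀ w, w ≠ v → G.Adj v (b w)) {u : V} (hu : ¬ G.Adj v u) :
    inflow q v φ b u = 0 :=
  Finset.sum_eq_zero fun w _ => by
    rw [if_neg]
    rintro ⟨h1, rfl⟩
    exact hu (hb w h1)

open Classical in
-- The weights ignore cuts: `cutHit` is raised to `φ`, and a nonnegative inflow is granted to every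
-- outlink, so the true surplus can only grow.
theorem sum_weight_pos_of_isImproving (hG : G.IsTree) (h0 : 0 < α) (h1 : α < 1)
    (hq : q ∈ stdSimplex ℝ V) (hr : IsRatio G α r) (hT : IsHitTable G r v φ b) {E F : Set V}
    (h : IsImproving G α q v E F) :
    0 < ∑ w ∈ Finset.univ.filter (· ∈ E ∪ F),
      weight G α q v φ b (Finset.univ.filter (· ∈ E ∪ F)).card w := by
  have hφ := hT.bounds hr hG h0 h1
  obtain ⟨hc, hiff⟩ := isImproving_iff hG h0 h1 hq hr hT h.1
  refine (hiff.1 h).trans_le ?_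
  rw [Finset.sum_filter]
  refine Finset.sum_le_sum fun w _ => ?_
  split_ifs with h2
  · have : cutHit v φ b E w ≤ φ w := by
      rw [cutHit]; split_ifs
      · exact le_rfl
      · exact (hφ w).1.le
    have : baseValue G α q v φ * (1 - α) * cutHit v φ b E w
        ≤ baseValue G α q v φ * (1 - α) * φ w :=
      mul_le_mul_of_nonneg_left this (mul_nonneg hc.le (by linarith))
    rw [weight]; linarith
  · have : cutHit v φ b E w ≤ φ w := by
      rw [cutHit]; split_ifs
      · exact le_rfl
      · exact (hφ w).1.le
    have : baseValue G α q v φ * (1 - α) * cutHit v φ b E w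
        ≤ baseValue G α q v φ * (1 - α) * φ w :=
      mul_le_mul_of_nonneg_left this (mul_nonneg hc.le (by linarith))
    have : 0 ≤ ((Finset.univ.filter (· ∈ E ∪ F)).card : ℝ) * inflow q v φ b w :=
      mul_nonneg (Nat.cast_nonneg _) (inflow_nonneg hq (fun w => (hφ w).1) w)
    rw [weight]; linarith
  · exact le_rfl

open Classical in
-- If `S` contains the branch of each of its members, no target of an outlink is cut off from `v`,
-- and the bound by weights is attained.
theorem isImproving_of_sum_weight_pos (hG : G.IsTree) (h0 : 0 < α) (h1 : α < 1)
    (hq : q ∈ stdSimplex ℝ V) (hr : IsRatio G α r) (hT : IsHitTable G r v φ b) {S : Finset V}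
    (hv : v ∉ S) (hb : ∀ w ∈ S, b w ∈ S) (h : 0 < ∑ w ∈ S, weight G α q v φ b S.card w) :
    IsImproving G α q v {w | w ∈ S ∧ G.Adj v w} {w | w ∈ S ∧ ¬ G.Adj v w} := by
  have hφ := hT.bounds hr hG h0 h1
  have hne : S.Nonempty := by
    by_contra hS
    rw [Finset.not_nonempty_iff_eq_empty] at hS
    simp [hS] at h
  have hmem : ∀ w, w ∈ ({w | w ∈ S ∧ G.Adj v w} ∪ {w | w ∈ S ∧ ¬ G.Adj v w} : Set V) ↔ w ∈ S := by
    intro w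
    simp only [Set.mem_union, Set.mem_ofPred_eq]
    tauto
  have hst : IsStrategy G v {w | w ∈ S ∧ G.Adj v w} {w | w ∈ S ∧ ¬ G.Adj v w} :=
    ⟨fun u hu => hu.2, fun u hu => ⟨hu.2, fun e => hv (e ▸ hu.1)⟩,
      hne.imp fun w hw => (hmem w).2 hw⟩
  obtain ⟨hc, hiff⟩ := isImproving_iff hG h0 h1 hq hr hT hst
  rw [hiff]
  simp only [hmem, Finset.filter_mem_eq_inter, Finset.univ_inter]
  rw [← Finset.sum_filter, Finset.filter_mem_eq_inter, Finset.univ_inter]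
  refine h.trans_le (Finset.sum_le_sum fun w hw => ?_)
  have hwv : w ≠ v := fun e => hv (e ▸ hw)
  have hcut : cutHit v φ b {w | w ∈ S ∧ G.Adj v w} w = φ w := by
    rw [cutHit, if_pos]
    exact .inr ⟨hb w hw, ((hφ w).2.2 hwv).2.1⟩
  rw [weight, hcut]
  by_cases ha : G.Adj v w
  · simp [hw, ha]
  · rw [inflow_eq_zero (G := G) (fun w hw => ((hφ w).2.2 hw).2.1) ha]
    simp

end Improving

/-! ### One candidate strategy for each number of outlinks -/

section Decision

variable {n : ℕ} {G : SimpleGraph (Fin n)} {α : ℝ} {q : Fin n → ℝ} {r : Fin n → Fin n → ℝ}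
  {v : Fin n} {φ : Fin n → ℝ} {b : Fin n → Fin n}

open Classical in
/-- The `k` other nodes of largest weight. -/
noncomputable def topSet (v : Fin n) (f : Fin n → ℝ) (k : ℕ) : Finset (Fin n) :=
  (Finset.univ.erase v).filter fun w => rankIn (Beats f) (Finset.univ.erase v) w < k

theorem exists_topSet_of_isImproving (hG : G.IsTree) (h0 : 0 < α) (h1 : α < 1)
    (hq : q ∈ stdSimplex ℝ (Fin n)) (hr : IsRatio G α r) (hT : IsHitTable G r v φ b)
    {E F : Set (Fin n)} (h : IsImproving G α q v E F) :
    ∃ k < n, 0 < ∑ w ∈ topSet v (weight G α q v φ b k) k, weight G α q v φ b k w := by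
  classical
  have hpos := sum_weight_pos_of_isImproving hG h0 h1 hq hr hT h
  have hsub : (Finset.univ.filter (· ∈ E ∪ F)) ⊆ Finset.univ.erase v := by
    intro w hw
    rw [Finset.mem_filter] at hw
    refine Finset.mem_erase.2 ⟨?_, Finset.mem_univ _⟩
    rcases hw.2 with h' | h'
    · rintro rfl; exact G.loopless.irrefl _ (h.1.retained w h')
    · exact (h.1.requested w h').2
  refine ⟨(Finset.univ.filter (· ∈ E ∪ F)).card, ?_, hpos.trans_le ?_⟩
  · have := Finset.card_le_card hsub
    rw [Finset.card_erase_of_mem (Finset.mem_univ v), Finset.card_univ, Fintype.card_fin] at this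
    have := v.pos
    omega
  · exact sum_le_sum_filter_rankIn_lt hsub fun x y hxy => hxy.le

/-- The top set is closed under `b`: for a non-neighbour `w` the node `b w` has larger `φ` and at
least the zero inflow of `w`, hence strictly larger weight and smaller rank. -/
theorem isImproving_topSet (hG : G.IsTree) (h0 : 0 < α) (h1 : α < 1)
    (hq : q ∈ stdSimplex ℝ (Fin n)) (hr : IsRatio G α r) (hT : IsHitTable G r v φ b) {k : ℕ}
    (hk : k < n)
    (h : 0 < ∑ w ∈ topSet v (weight G α q v φ b k) k, weight G α q v φ b k w) :
    IsImproving G α q v {w | w ∈ topSet v (weight G α q v φ b k) k ∧ G.Adj v w}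
      {w | w ∈ topSet v (weight G α q v φ b k) k ∧ ¬ G.Adj v w} := by
  classical
  have hφ := hT.bounds hr hG h0 h1
  have hcard : (topSet v (weight G α q v φ b k) k).card = k := by
    apply card_filter_rankIn_lt
    rw [Finset.card_erase_of_mem (Finset.mem_univ v), Finset.card_univ, Fintype.card_fin]
    omega
  have hvn : v ∉ topSet v (weight G α q v φ b k) k := by simp [topSet]
  refine isImproving_of_sum_weight_pos hG h0 h1 hq hr hT hvn ?_ (by rwa [hcard])
  intro w hw
  have hwv : w ≠ v := fun e => hvn (e ▸ hw)
  obtain ⟨-, hadj, -, hlt⟩ := (hφ w).2.2 hwv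
  by_cases hbw : w = b w
  · rwa [← hbw]
  · rw [topSet, Finset.mem_filter, Finset.mem_erase] at hw ⊢
    have hbv : b w ≠ v := hadj.ne'
    have hbm : b w ∈ Finset.univ.erase v := Finset.mem_erase.2 ⟨hbv, Finset.mem_univ _⟩
    refine ⟨⟨hbv, Finset.mem_univ _⟩, lt_trans (rankIn_lt_rankIn hbm (beats_of_lt ?_)) hw.2⟩
    have hc : 0 < baseValue G α q v φ := by
      refine (isImproving_iff hG h0 h1 hq hr hT (E := G.neighborSet v) (F := ∅)
        ⟨fun u hu => hu, fun u hu => hu.elim, ⟨b w, .inl hadj⟩⟩).1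
    have hna : ¬ G.Adj v w := fun ha => hbw (hT.adj w ha.symm).symm
    rw [weight, weight, inflow_eq_zero (G := G) (fun w hw => ((hφ w).2.2 hw).2.1) hna]
    have h2 : 0 ≤ (k : ℝ) * inflow q v φ b (b w) :=
      mul_nonneg (Nat.cast_nonneg _) (inflow_nonneg hq (fun w => (hφ w).1) _)
    have h3 := mul_lt_mul_of_pos_left (hlt hbw) (mul_pos hc (by linarith : 0 < 1 - α))
    linarith

end Decision

/-! ### The program: shared tests and memory layout -/

theorem Halts.forUp_const {i n : ℕ} {p : Prog} {s : State} (c : ℕ) (Inv : ℕ → State → Prop)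
    (hn : s.nvar 10 = n) (hi : p.writesN i = false) (h10 : p.writesN 10 = false) (hi10 : 10 ≠ i)
    (h0 : Inv 0 (s.withN i 0))
    (hstep : ∀ j < n, ∀ s', Frame (.forUp i p) s s' → s'.nvar i = j → Inv j s' →
      Halts p s' c (fun s'' => Inv (j + 1) (s''.withN i (j + 1)))) :
    Halts (.forUp i p) s (n * (c + 8) + 6) (fun s' => Inv n s' ∧ Frame (.forUp i p) s s') := by
  have := Halts.forUp (c := fun _ => c) Inv hn hi h10 hi10 h0 hstep
  simpa using this

/-- Address of the entry `(u, w)` of a matrix, for the indices in the integer variables `u`, `w`;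
integer array `3` holds the offsets of the rows. -/
def NExp.entry (u w : ℕ) : NExp := .add (.get 3 (.var u)) (.var w)

/-- The nodes in the integer variables `u` and `w` are adjacent. -/
def Test.adj (u w : ℕ) : Test := .nlt (.const 0) (.get 0 (.entry u w))

/-- The integer variables `i` and `j` differ. -/
def Test.ne (i j : ℕ) : Test :=
  .not (.and (.not (.nlt (.var i) (.var j))) (.not (.nlt (.var j) (.var i))))

/-- The node in the integer variable `x` precedes the one in `y` by decreasing entry of the real
array `3`. -/
def Test.beats (x y : ℕ) : Test :=
  .not (.and
    (.not (.and (.nlt (.var x) (.var y)) (.not (.rlt (.get 3 (.var x)) (.get 3 (.var y))))))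
    (.not (.and (.not (.nlt (.var x) (.var y))) (.rlt (.get 3 (.var y)) (.get 3 (.var x))))))

theorem Test.holds_ne (s : State) (i j : ℕ) : (Test.ne i j).Holds s ↔ s.nvar i ≠ s.nvar j := by
  simp only [Test.ne, Test.Holds, NExp.eval]; omega

theorem Test.holds_beats (s : State) (x y : ℕ) :
    (Test.beats x y).Holds s ↔ Beats (s.rarr 3) (s.nvar x) (s.nvar y) := by
  simp only [Test.beats, Test.Holds, NExp.eval, RExp.eval, Beats]
  split_ifs <;> tauto

/-- The part of the memory that holds the input. -/
structure HasInput (n : ℕ) (A : ℕ → ℕ → Prop) (α : ℝ) (q : ℕ → ℝ) (s : State) : Prop where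
  size : s.nvar 10 = n
  row : ∀ u < n, s.narr 3 u = u * n
  adj : ∀ u < n, ∀ w < n, 0 < s.narr 0 (u * n + w) ↔ A u w
  damp : s.rvar 0 = α
  jump : s.rarr 0 = q

/-- The program does not write to the memory that holds the input. -/
def Prog.keepsInput (p : Prog) : Bool :=
  !(p.writesN 10) && !(p.writesNArr 3) && !(p.writesNArr 0) && !(p.writesR 0) && !(p.writesRArr 0)

theorem HasInput.frame {n : ℕ} {A : ℕ → ℕ → Prop} {α : ℝ} {q : ℕ → ℝ} {s s' : State}
    (h : HasInput n A α q s) {p : Prog} (hF : Frame p s s') (hp : p.keepsInput = true) :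
    HasInput n A α q s' := by
  simp only [Prog.keepsInput, Bool.and_eq_true, Bool.not_eq_true'] at hp
  obtain ⟨⟨⟨⟨p1, p2⟩, p3⟩, p4⟩, p5⟩ := hp
  exact ⟨by rw [hF.nvar _ p1, h.size], by rw [hF.narr _ p2]; exact h.row,
    by rw [hF.narr _ p3]; exact h.adj, by rw [hF.rvar _ p4, h.damp], by rw [hF.rarr _ p5, h.jump]⟩

theorem NExp.eval_entry {n : ℕ} {A : ℕ → ℕ → Prop} {α : ℝ} {q : ℕ → ℝ} {s : State}
    (h : HasInput n A α q s) {u w : ℕ} (hu : s.nvar u < n) :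
    (NExp.entry u w).eval s = s.nvar u * n + s.nvar w := by
  simp [NExp.entry, NExp.eval, h.row _ hu]

theorem Test.holds_adj {n : ℕ} {A : ℕ → ℕ → Prop} {α : ℝ} {q : ℕ → ℝ} {s : State}
    (h : HasInput n A α q s) {u w : ℕ} (hu : s.nvar u < n) (hw : s.nvar w < n) :
    (Test.adj u w).Holds s ↔ A (s.nvar u) (s.nvar w) := by
  rw [← h.adj _ hu _ hw, Test.adj, Test.Holds, NExp.eval, NExp.eval, NExp.eval_entry h hu]

theorem entry_inj {n u w u' w' : ℕ} (hw : w < n) (hw' : w' < n) :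
    u' * n + w' = u * n + w ↔ u' = u ∧ w' = w := by
  constructor
  · intro h
    have h1 : (w' + n * u') / n = (w + n * u) / n := by congr 1; linarith
    rw [Nat.add_mul_div_left _ _ (by omega), Nat.add_mul_div_left _ _ (by omega),
      Nat.div_eq_of_lt hw, Nat.div_eq_of_lt hw', zero_add, zero_add] at h1
    subst h1
    exact ⟨rfl, by omega⟩
  · rintro ⟨rfl, rfl⟩; rfl

theorem update_entry {β : Type*} {n u w u' w' : ℕ} (f : ℕ → β) (x : β) (hw : w < n) (hw' : w' < n) :
    Function.update f (u * n + w) x (u' * n + w')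
      = if u' = u ∧ w' = w then x else f (u' * n + w') := by
  rw [Function.update_apply]
  simp only [entry_inj hw hw']

/-! ### First phase: the ratios -/

/-- Sums up the denominator for the dart in the integer variables `12` and `13`. -/
def ratioSum : Prog :=
  .forUp 14 (.ite (.and (.adj 12 14) (.ne 14 13))
    (.setR 1 (.add (.var 1) (.sub .one (.mul (.sub .one (.var 0)) (.get 1 (.entry 14 12))))))
    .skip)

/-- Updates the ratio for the dart in the integer variables `12` and `13`. -/
def ratioUpdate : Prog :=
  .seq (.setR 1 .one)
    (.seq ratioSum (.putR 1 (.entry 12 13) (.div (.sub .one (.var 0)) (.var 1))))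

/-- Updates the ratios for all darts. -/
def ratioRound : Prog := .forUp 12 (.forUp 13 (.ite (.adj 12 13) ratioUpdate .skip))

/-- Computes the ratios for all darts. -/
def ratioPhase : Prog := .forUp 11 ratioRound

section Ratio

variable {n : ℕ} {A : ℕ → ℕ → Prop} {α : ℝ} {q : ℕ → ℝ}

open Classical in
/-- The value assigned to the ratio of the dart `w → p`. -/
noncomputable def ratioVal (n : ℕ) (A : ℕ → ℕ → Prop) (α : ℝ) (f : ℕ → ℝ) (w p : ℕ) : ℝ :=
  (1 - α) / (1 + ∑ c ∈ Finset.range n, if A w c ∧ c ≠ p then 1 - (1 - α) * f (c * n + w) else 0)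

open Classical in
-- The 42 is a generous bound for `maxCost` of the loop body; the numerals in the other loops arise
-- in the same way.
theorem ratioSum_halts {s : State} (h : HasInput n A α q s) (hw : s.nvar 12 < n) :
    Halts ratioSum s (n * 50 + 6) (fun s' => s'.rvar 1 = s.rvar 1 + ∑ c ∈ Finset.range n,
      if A (s.nvar 12) c ∧ c ≠ s.nvar 13 then
        1 - (1 - α) * s.rarr 1 (c * n + s.nvar 12) else 0) := by
  refine (Halts.forUp_const 42 (fun j s' => s'.rvar 1 = s.rvar 1 + ∑ c ∈ Finset.range j,
      if A (s.nvar 12) c ∧ c ≠ s.nvar 13 then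
        1 - (1 - α) * s.rarr 1 (c * n + s.nvar 12) else 0) h.size rfl rfl (by decide) (by simp)
        ?_).mono le_rfl (fun _ h => h.1)
  intro j hj s' hF hj' hI
  have h' := h.frame hF rfl
  have e12 : s'.nvar 12 = s.nvar 12 := hF.nvar _ rfl
  have e13 : s'.nvar 13 = s.nvar 13 := hF.nvar _ rfl
  have er : s'.rarr 1 = s.rarr 1 := hF.rarr _ rfl
  refine (Halts.of_loopFree rfl ?_).mono (by decide) (fun _ h => h)
  rw [Finset.sum_range_succ, ← add_assoc, ← hI]
  simp only [Prog.exec, Test.Holds, Test.holds_ne,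
    Test.holds_adj h' (show s'.nvar 12 < n by omega) (show s'.nvar 14 < n by omega), e12, e13, hj',
    RExp.eval, NExp.eval_entry h' (show s'.nvar 14 < n by omega), er, h'.damp]
  split_ifs with h1
  · simp
  · simp

open Classical in
theorem ratioUpdate_halts {s : State} (h : HasInput n A α q s) (hw : s.nvar 12 < n) :
    Halts ratioUpdate s (n * 50 + 20) (fun s' => s'.rarr 1 = Function.update (s.rarr 1)
      (s.nvar 12 * n + s.nvar 13) (ratioVal n A α (s.rarr 1) (s.nvar 12) (s.nvar 13))) := by
  refine ((Halts.of_loopFree (Q := fun s' => s' = (Prog.setR 1 .one).exec s) rfl rfl).seq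
    (C := n * 50 + 16) ?_).mono (by simp [Prog.maxCost, RExp.cost]; omega) (fun _ h => h)
  rintro s' rfl
  set s1 := (Prog.setR 1 .one).exec s with hs1
  have h1 : HasInput n A α q s1 := ⟨h.size, h.row, h.adj, by simpa [hs1, Prog.exec] using h.damp, h.jump⟩
  refine ((ratioSum_halts h1 hw).frame.seq (C := 10) ?_).mono (by omega) (fun _ h => h)
  rintro s2 ⟨hs2, hF⟩
  have h2 := h1.frame hF rfl
  have e12 : s2.nvar 12 = s.nvar 12 := hF.nvar _ rfl
  have e13 : s2.nvar 13 = s.nvar 13 := hF.nvar _ rfl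
  have er : s2.rarr 1 = s.rarr 1 := hF.rarr _ rfl
  refine (Halts.of_loopFree rfl ?_).mono (by decide) (fun _ h => h)
  simp only [Prog.exec, Function.update_self, NExp.eval_entry h2 (show s2.nvar 12 < n by omega),
    e12, e13, er, RExp.eval, h2.damp, hs2, ratioVal]
  simp [hs1, Prog.exec, RExp.eval]

/-- A ranking of the darts along which the ratios can be computed. -/
structure IsDartRank (n : ℕ) (A : ℕ → ℕ → Prop) (l : ℕ → ℕ → ℕ) : Prop where
  irrefl : ∀ w, ¬ A w w
  pos : ∀ w p, A w p → 0 < l w p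
  le : ∀ w p, A w p → l w p ≤ n
  lt : ∀ w p c, A w p → A w c → c ≠ p → l c w < l w p

/-- The ratios of the darts in `P` are correct, where `P` contains all darts of rank at most `t`
and no darts of rank more than `t + 1`. -/
def RatioInv (n : ℕ) (A : ℕ → ℕ → Prop) (α : ℝ) (l : ℕ → ℕ → ℕ) (t : ℕ) (P : ℕ → ℕ → Prop)
    (f : ℕ → ℝ) : Prop :=
  ∀ w < n, ∀ p < n, A w p → (l w p ≤ t ∨ l w p = t + 1 ∧ P w p) →
    f (w * n + p) = ratioVal n A α f w p

/-- Recomputing a dart of rank at most `t` stores the value already there. A dart of larger rank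
does not enter the formula of any dart of rank at most `t + 1`, since that formula uses strictly
smaller ranks only. -/
theorem RatioInv.update {l : ℕ → ℕ → ℕ} (hl : IsDartRank n A l) {t : ℕ} {P P' : ℕ → ℕ → Prop}
    {f : ℕ → ℝ} (h : RatioInv n A α l t P f) {x y : ℕ} (hx : x < n) (hy : y < n) (hA : A x y)
    (hP : ∀ w p, P' w p → P w p ∨ w = x ∧ p = y) :
    RatioInv n A α l t P' (Function.update f (x * n + y) (ratioVal n A α f x y)) := by
  classical
  by_cases ht : l x y ≤ t
  · rw [← h x hx y hy hA (.inl ht), Function.update_eq_self]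
    intro w hw p hp hwp h'
    rcases h' with h' | ⟨h', h''⟩
    · exact h w hw p hp hwp (.inl h')
    · rcases hP w p h'' with h3 | ⟨rfl, rfl⟩
      · exact h w hw p hp hwp (.inr ⟨h', h3⟩)
      · omega
  · intro w hw p hp hwp h'
    have hle : l w p ≤ t + 1 := by omega
    have hval : ratioVal n A α (Function.update f (x * n + y) (ratioVal n A α f x y)) w p
        = ratioVal n A α f w p := by
      unfold ratioVal
      congr 2
      refine Finset.sum_congr rfl fun c hc => ?_
      split_ifs with h3
      · rw [update_entry _ _ hy hw, if_neg]
        rintro ⟨rfl, rfl⟩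
        have := hl.lt w p c hwp h3.1 h3.2
        omega
      · rfl
    rw [hval, update_entry _ _ hy hp]
    split_ifs with h3
    · rw [h3.1, h3.2]
    · apply h w hw p hp hwp
      rcases h' with h' | ⟨h', h''⟩
      · exact .inl h'
      · exact .inr ⟨h', (hP w p h'').resolve_right h3⟩

open Classical in
/-- The number of darts from `w`. -/
noncomputable def dartCount (n : ℕ) (A : ℕ → ℕ → Prop) (w : ℕ) : ℕ :=
  ∑ p ∈ Finset.range n, if A w p then 1 else 0

/-- One pass, in any order of the darts, completes the next rank. -/
theorem ratioRound_halts {l : ℕ → ℕ → ℕ} (hl : IsDartRank n A l) {t : ℕ} {s : State}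
    (h : HasInput n A α q s) (hI : RatioInv n A α l t (fun _ _ => False) (s.rarr 1)) :
    Halts ratioRound s
      ((∑ w ∈ Finset.range n, (n * 20 + dartCount n A w * (n * 50 + 20) + 6 + 8)) + 6)
      (fun s' => RatioInv n A α l (t + 1) (fun _ _ => False) (s'.rarr 1)) := by
  classical
  refine (Halts.forUp (c := fun w => n * 20 + dartCount n A w * (n * 50 + 20) + 6)
    (fun j s' => RatioInv n A α l t (fun w _ => w < j) (s'.rarr 1))
    h.size rfl rfl (by decide) (by simpa using hI) ?_).mono le_rfl ?_
  · intro w hw s1 hF1 hw1 hI1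
    have h1 := h.frame hF1 rfl
    -- The linear cost of an update is charged to actual darts only; a non-adjacent pair costs a
    -- constant.
    refine (Halts.forUp (c := fun p => 12 + (if A w p then 1 else 0) * (n * 50 + 20))
      (fun j s' => RatioInv n A α l t (fun w' p => w' < w ∨ w' = w ∧ p < j) (s'.rarr 1))
      h1.size rfl rfl (by decide) (by simpa using hI1) ?_).mono ?_ ?_
    · intro p hp s2 hF2 hp2 hI2
      have h2 := h1.frame hF2 rfl
      have e12 : s2.nvar 12 = w := (hF2.nvar _ rfl).trans hw1
      by_cases hA : A w p
      · have hA' : (Test.adj 12 13).Holds s2 := by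
          rw [Test.holds_adj h2 (by omega) (by omega), e12, hp2]; exact hA
        refine (Halts.ite_of_pos hA' (ratioUpdate_halts h2 (by omega))).mono ?_ ?_
        · simp [hA, Test.adj, Test.cost, NExp.cost, NExp.entry]
        · intro s3 hs3
          rw [State.withN_rarr, hs3, e12, hp2]
          refine hI2.update hl hw hp hA fun a b hab => ?_
          omega
      · have hA' : ¬ (Test.adj 12 13).Holds s2 := by
          rw [Test.holds_adj h2 (by omega) (by omega), e12, hp2]; exact hA
        refine (Halts.ite_of_neg (Q := fun s => s = s2) hA' (Halts.of_loopFree rfl rfl)).mono ?_ ?_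
        · simp [hA, Test.adj, Test.cost, NExp.cost, NExp.entry, Prog.maxCost]
        · rintro s3 rfl a ha b hb hab h'
          apply hI2 a ha b hb hab
          rcases h' with h' | ⟨h', h'' | ⟨rfl, h''⟩⟩
          · exact .inl h'
          · exact .inr ⟨h', .inl h''⟩
          · have : b ≠ p := by rintro rfl; exact hA hab
            exact .inr ⟨h', .inr ⟨rfl, by omega⟩⟩
    · rw [dartCount, Finset.sum_mul]
      simp only [Finset.sum_add_distrib, Finset.sum_const, Finset.card_range, smul_eq_mul]
      omega
    · rintro s3 ⟨hI3, -⟩ a ha b hb hab h'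
      apply hI3 a ha b hb hab
      beta_reduce at h' ⊢
      omega
  · rintro s1 ⟨hI1, -⟩ a ha b hb hab h'
    apply hI1 a ha b hb hab
    rcases h' with h' | ⟨-, h'⟩
    · omega
    · exact h'.elim

theorem ratioPhase_halts {l : ℕ → ℕ → ℕ} (hl : IsDartRank n A l) {s : State}
    (h : HasInput n A α q s) :
    Halts ratioPhase s
      (n * (((∑ w ∈ Finset.range n, (n * 20 + dartCount n A w * (n * 50 + 20) + 6 + 8)) + 6) + 8) + 6)
      (fun s' => ∀ w < n, ∀ p < n, A w p →
        s'.rarr 1 (w * n + p) = ratioVal n A α (s'.rarr 1) w p) := by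
  refine (Halts.forUp_const _ (fun t s' => RatioInv n A α l t (fun _ _ => False) (s'.rarr 1))
    h.size rfl rfl (by decide) ?_ ?_).mono le_rfl ?_
  · intro w _ p _ hA h'
    have := hl.pos w p hA
    rcases h' with h' | ⟨-, h'⟩
    · omega
    · exact h'.elim
  · intro t ht s1 hF1 ht1 hI1
    exact ratioRound_halts hl (h.frame hF1 rfl) hI1
  · rintro s1 ⟨hI1, -⟩ w hw p hp hA
    exact hI1 w hw p hp hA (.inl (hl.le w p hA))

end Ratio

/-! ### Second phase: hitting probabilities and branches -/

/-- Every node has hitting probability one to itself and a nonzero label. -/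
def hitInit : Prog :=
  .forUp 11 (.seq (.putR 2 (.entry 11 11) .one) (.putN 4 (.entry 11 11) (.const 1)))

/-- Propagates hitting probability and label for the target in the integer variable `14` along the
dart in the integer variables `12` and `13`. -/
def hitRelax : Prog :=
  .ite (.and (.nlt (.const 0) (.get 4 (.entry 14 13))) (.not (.nlt (.const 0) (.get 4 (.entry 14 12)))))
    (.seq (.putR 2 (.entry 14 12) (.mul (.get 1 (.entry 12 13)) (.get 2 (.entry 14 13))))
      (.ite (.ne 13 14) (.putN 4 (.entry 14 12) (.get 4 (.entry 14 13)))
        (.putN 4 (.entry 14 12) (.add (.var 12) (.const 1)))))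
    .skip

/-- Propagates along all darts. -/
def hitRound : Prog := .forUp 12 (.forUp 13 (.ite (.adj 12 13) (.forUp 14 hitRelax) .skip))

/-- Computes all hitting probabilities and labels. -/
def hitPhase : Prog := .seq hitInit (.forUp 11 hitRound)

section Hit

variable {n : ℕ} {A : ℕ → ℕ → Prop} {α : ℝ} {q : ℕ → ℝ}

/-- `d` is the distance function of the tree with adjacency relation `A` on `{0, …, n - 1}`. -/
structure IsTreeDist (n : ℕ) (A : ℕ → ℕ → Prop) (d : ℕ → ℕ → ℕ) : Prop where
  self : ∀ v < n, d v v = 0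
  symm : ∀ u w, A u w → A w u
  dichotomy : ∀ v < n, ∀ w < n, ∀ p < n, A w p → d v w = d v p + 1 ∨ d v p = d v w + 1
  unique : ∀ v < n, ∀ w < n, ∀ p < n, ∀ p' < n, A w p → A w p' → d v w = d v p + 1 →
    d v w = d v p' + 1 → p = p'
  parent : ∀ v < n, ∀ w < n, w ≠ v → ∃ p < n, A w p ∧ d v w = d v p + 1
  lt : ∀ v < n, ∀ w < n, d v w < n

/-- The entries for target `v` are correct wherever the label is nonzero. -/
structure HitInv (n : ℕ) (A : ℕ → ℕ → Prop) (d : ℕ → ℕ → ℕ) (r f : ℕ → ℝ) (b : ℕ → ℕ) (v : ℕ) :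
    Prop where
  self : f (v * n + v) = 1 ∧ b (v * n + v) ≠ 0
  step : ∀ w < n, ∀ p < n, A w p → d v w = d v p + 1 → b (v * n + w) ≠ 0 →
    b (v * n + p) ≠ 0 ∧ f (v * n + w) = r (w * n + p) * f (v * n + p) ∧
      b (v * n + w) = if p = v then w + 1 else b (v * n + p)

/-- The labelled nodes are closed under passing to the parent towards `v`. So if `p` is labelled and
its neighbour `w` is not, then `p` is the parent of `w`, and distances never have to be computed. -/
theorem HitInv.update {d : ℕ → ℕ → ℕ} (hd : IsTreeDist n A d) {r f : ℕ → ℝ} {b : ℕ → ℕ}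
    {v w p : ℕ} (h : HitInv n A d r f b v) (hv : v < n) (hw : w < n) (hp : p < n)
    (hA : A w p) (hbp : b (v * n + p) ≠ 0) (hbw : b (v * n + w) = 0) :
    HitInv n A d r
      (Function.update f (v * n + w) (r (w * n + p) * f (v * n + p)))
      (Function.update b (v * n + w) (if p = v then w + 1 else b (v * n + p))) v := by
  have hwv : w ≠ v := by rintro rfl; exact h.self.2 hbw
  have hpw : p ≠ w := by rintro rfl; exact hbp hbw
  have hdw : d v w = d v p + 1 := by
    rcases hd.dichotomy v hv w hw p hp hA with h1 | h1
    · exact h1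
    · exact absurd hbw (h.step p hp w hw (hd.symm _ _ hA) h1 hbp).1
  constructor
  · rw [update_entry _ _ hw hv, update_entry _ _ hw hv, if_neg (fun e => hwv e.2.symm),
      if_neg (fun e => hwv e.2.symm)]
    exact h.self
  · intro w' hw' p' hp' hA' hd' hb'
    simp only [update_entry _ _ hw hw', update_entry _ _ hw hp', true_and] at hb' ⊢
    by_cases h1 : w' = w
    · subst h1
      obtain rfl : p = p' := hd.unique v hv w' hw' p hp p' hp' hA hA' hdw hd'
      simp [hpw, hbp]
    · rw [if_neg h1] at hb'
      have h2 := h.step w' hw' p' hp' hA' hd' hb'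
      have h3 : p' ≠ w := by rintro rfl; exact h2.1 hbw
      simp only [if_neg h1, if_neg h3]
      exact h2

theorem HitInv.congr {d : ℕ → ℕ → ℕ} {r f f' : ℕ → ℝ} {b b' : ℕ → ℕ} {v : ℕ}
    (h : HitInv n A d r f b v) (hv : v < n) (hf : ∀ w < n, f' (v * n + w) = f (v * n + w))
    (hb : ∀ w < n, b' (v * n + w) = b (v * n + w)) : HitInv n A d r f' b' v := by
  constructor
  · rw [hf v hv, hb v hv]; exact h.self
  · intro w hw p hp
    rw [hf w hw, hb w hw, hf p hp, hb p hp]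
    exact h.step w hw p hp

theorem hitInit_halts {d : ℕ → ℕ → ℕ} {s : State} (h : HasInput n A α q s)
    (hb : s.narr 4 = fun _ => 0) {r : ℕ → ℝ} (hd : IsTreeDist n A d) :
    Halts hitInit s (n * 30 + 6) (fun s' => ∀ v < n, HitInv n A d r (s'.rarr 2) (s'.narr 4) v) := by
  refine (Halts.forUp_const 22 (fun j s' => (∀ v < n, ∀ w < n, s'.narr 4 (v * n + w) ≠ 0 → v = w) ∧
    ∀ v < j, s'.rarr 2 (v * n + v) = 1 ∧ s'.narr 4 (v * n + v) ≠ 0) h.size rfl rfl (by decide)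
    ⟨by simp [hb], by simp⟩ ?_).mono le_rfl ?_
  · rintro j hj s1 hF hj1 ⟨hI, hI'⟩
    have h1 := h.frame hF rfl
    refine (Halts.of_loopFree rfl ?_).mono (by decide) (fun _ h => h)
    have e := h1.row j hj
    have e4 : ((Prog.seq (.putR 2 (.entry 11 11) .one) (.putN 4 (.entry 11 11) (.const 1))).exec
        s1).narr 4 = Function.update (s1.narr 4) (j * n + j) 1 := by
      simp [Prog.exec, NExp.entry, NExp.eval, hj1, e]
    have e2 : ((Prog.seq (.putR 2 (.entry 11 11) .one) (.putN 4 (.entry 11 11) (.const 1))).exec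
        s1).rarr 2 = Function.update (s1.rarr 2) (j * n + j) 1 := by
      simp [Prog.exec, NExp.entry, NExp.eval, RExp.eval, hj1, e]
    rw [State.withN_narr, State.withN_rarr, e2, e4]
    constructor
    · intro v hv w hw
      rw [update_entry _ _ hj hw]
      split_ifs with h2
      · intro _; omega
      · exact hI v hv w hw
    · intro v hv
      rw [update_entry _ _ hj (by omega), update_entry _ _ hj (by omega)]
      split_ifs with h2
      · simp
      · exact hI' v (by omega)
  · rintro s1 ⟨⟨hI, hI'⟩, -⟩ v hv
    refine ⟨hI' v hv, fun w hw p hp hA hdw hb => ?_⟩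
    -- Initially only `v` is labelled for the target `v`, and it has distance 0, so no parent
    -- equation applies. Its label is a mere marker; elsewhere the label is the branch plus one,
    -- with 0 for unset.
    obtain rfl := hI v hv w hw hb
    have := hd.self v hv
    omega

/-- All labels set so far are correct, and the labels within distance `t`, as well as those within
distance `t + 1` whose darts are in `P`, are set. -/
def HitReach (n : ℕ) (A : ℕ → ℕ → Prop) (d : ℕ → ℕ → ℕ) (r : ℕ → ℝ) (t : ℕ)
    (P : ℕ → ℕ → ℕ → Prop) (f : ℕ → ℝ) (b : ℕ → ℕ) : Prop :=
  ∀ v < n, HitInv n A d r f b v ∧ (∀ w < n, d v w ≤ t → b (v * n + w) ≠ 0) ∧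
    ∀ w < n, ∀ p < n, A w p → d v w = d v p + 1 → d v p ≤ t → P v w p → b (v * n + w) ≠ 0

theorem HitReach.mono {d : ℕ → ℕ → ℕ} {r f : ℕ → ℝ} {b : ℕ → ℕ} {t : ℕ} {P P' : ℕ → ℕ → ℕ → Prop}
    (h : HitReach n A d r t P f b)
    (hP : ∀ v < n, ∀ w < n, ∀ p < n, A w p → P' v w p → P v w p) : HitReach n A d r t P' f b :=
  fun v hv => ⟨(h v hv).1, (h v hv).2.1, fun w hw p hp hA h1 h2 h3 =>
    (h v hv).2.2 w hw p hp hA h1 h2 (hP v hv w hw p hp hA h3)⟩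

theorem hitRelax_halts {d : ℕ → ℕ → ℕ} (hd : IsTreeDist n A d) {r : ℕ → ℝ} {t : ℕ}
    {P P' : ℕ → ℕ → ℕ → Prop} {s : State} (h : HasInput n A α q s) (hr : s.rarr 1 = r)
    (hI : HitReach n A d r t P (s.rarr 2) (s.narr 4)) {v w p : ℕ} (hw : s.nvar 12 = w)
    (hp : s.nvar 13 = p) (hv : s.nvar 14 = v) (hwn : w < n) (hpn : p < n) (hvn : v < n)
    (hA : A w p) (hP : ∀ a b c, P' a b c → P a b c ∨ a = v ∧ b = w ∧ c = p) :
    Halts hitRelax s 80 (fun s' => HitReach n A d r t P' (s'.rarr 2) (s'.narr 4)) := by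
  classical
  refine (Halts.of_loopFree rfl ?_).mono (by decide) (fun _ h => h)
  have r1 := h.row v hvn
  have r2 := h.row w hwn
  have hres : (hitRelax.exec s).rarr 2 = (if 0 < s.narr 4 (v * n + p) ∧ ¬ 0 < s.narr 4 (v * n + w) then
        Function.update (s.rarr 2) (v * n + w) (r (w * n + p) * s.rarr 2 (v * n + p)) else s.rarr 2) ∧
      (hitRelax.exec s).narr 4 = (if 0 < s.narr 4 (v * n + p) ∧ ¬ 0 < s.narr 4 (v * n + w) then
        Function.update (s.narr 4) (v * n + w) (if p = v then w + 1 else s.narr 4 (v * n + p))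
        else s.narr 4) := by
    simp only [hitRelax, Prog.exec, Test.Holds, Test.holds_ne, NExp.entry, NExp.eval, RExp.eval, hw,
      hp, hv, r1, r2, hr]
    by_cases hc : 0 < s.narr 4 (v * n + p) ∧ ¬ 0 < s.narr 4 (v * n + w)
    · rw [if_pos hc, if_pos hc, if_pos hc]
      by_cases hpv : p = v <;> simp [hpv]
    · rw [if_neg hc, if_neg hc, if_neg hc]
      exact ⟨rfl, rfl⟩
  rw [hres.1, hres.2]
  by_cases hc : 0 < s.narr 4 (v * n + p) ∧ ¬ 0 < s.narr 4 (v * n + w)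
  · rw [if_pos hc, if_pos hc]
    rw [Nat.pos_iff_ne_zero, Nat.pos_iff_ne_zero, not_not] at hc
    intro a ha
    by_cases hav : a = v
    · subst hav
      have hset : ∀ x < n, s.narr 4 (a * n + x) ≠ 0 → Function.update (s.narr 4) (a * n + w)
          (if p = a then w + 1 else s.narr 4 (a * n + p)) (a * n + x) ≠ 0 := by
        intro x hx h1
        rw [update_entry _ _ hwn hx]
        by_cases h2 : x = w
        · rw [if_pos ⟨rfl, h2⟩]
          split_ifs
          · omega
          · exact hc.1
        · rw [if_neg (fun e => h2 e.2)]
          exact h1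
      refine ⟨(hI a ha).1.update hd ha hwn hpn hA hc.1 hc.2, fun x hx hdx =>
        hset x hx ((hI a ha).2.1 x hx hdx), fun x hx y hy hxy h1 h2 h3 => ?_⟩
      rcases hP _ _ _ h3 with h4 | ⟨-, rfl, rfl⟩
      · exact hset x hx ((hI a ha).2.2 x hx y hy hxy h1 h2 h4)
      · rw [Function.update_self]
        split_ifs
        · omega
        · exact hc.1
    · have hf : ∀ x < n, Function.update (s.rarr 2) (v * n + w)
          (r (w * n + p) * s.rarr 2 (v * n + p)) (a * n + x) = s.rarr 2 (a * n + x) := by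
        intro x hx
        rw [update_entry _ _ hwn hx, if_neg (fun e => hav e.1)]
      have hb : ∀ x < n, Function.update (s.narr 4) (v * n + w)
          (if p = v then w + 1 else s.narr 4 (v * n + p)) (a * n + x) = s.narr 4 (a * n + x) := by
        intro x hx
        rw [update_entry _ _ hwn hx, if_neg (fun e => hav e.1)]
      refine ⟨(hI a ha).1.congr ha hf hb, fun x hx hdx => ?_, fun x hx y hy hxy h1 h2 h3 => ?_⟩
      · rw [hb x hx]; exact (hI a ha).2.1 x hx hdx
      · rw [hb x hx]
        rcases hP _ _ _ h3 with h4 | ⟨h4, -⟩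
        · exact (hI a ha).2.2 x hx y hy hxy h1 h2 h4
        · exact absurd h4 hav
  · rw [if_neg hc, if_neg hc]
    rw [Nat.pos_iff_ne_zero, Nat.pos_iff_ne_zero, not_not] at hc
    intro a ha
    refine ⟨(hI a ha).1, (hI a ha).2.1, fun x hx y hy hxy h1 h2 h3 => ?_⟩
    rcases hP _ _ _ h3 with h4 | ⟨rfl, rfl, rfl⟩
    · exact (hI a ha).2.2 x hx y hy hxy h1 h2 h4
    · intro h5
      -- Nothing is written, but `y` has distance at most `t` and is labelled, so `x` must have been
      -- labelled before.
      exact hc ⟨(hI a ha).2.1 y hy h2, h5⟩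

theorem hitRound_halts {d : ℕ → ℕ → ℕ} (hd : IsTreeDist n A d) {r : ℕ → ℝ} {t : ℕ}
    {s : State} (h : HasInput n A α q s) (hr : s.rarr 1 = r)
    (hI : HitReach n A d r t (fun _ _ _ => False) (s.rarr 2) (s.narr 4)) :
    Halts hitRound s
      ((∑ w ∈ Finset.range n, (n * 20 + dartCount n A w * (n * 88 + 6) + 6 + 8)) + 6)
      (fun s' => HitReach n A d r (t + 1) (fun _ _ _ => False) (s'.rarr 2) (s'.narr 4)) := by
  classical
  refine (Halts.forUp (c := fun w => n * 20 + dartCount n A w * (n * 88 + 6) + 6)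
    (fun j s' => HitReach n A d r t (fun _ w _ => w < j) (s'.rarr 2) (s'.narr 4))
    h.size rfl rfl (by decide) (by simpa using hI) ?_).mono le_rfl ?_
  · intro w hw s1 hF1 hw1 hI1
    have h1 := h.frame hF1 rfl
    refine (Halts.forUp (c := fun p => 12 + (if A w p then 1 else 0) * (n * 88 + 6))
      (fun j s' => HitReach n A d r t (fun _ w' p => w' < w ∨ w' = w ∧ p < j) (s'.rarr 2) (s'.narr 4))
      h1.size rfl rfl (by decide) (by simpa using hI1) ?_).mono ?_ ?_
    · intro p hp s2 hF2 hp2 hI2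
      have h2 := h1.frame hF2 rfl
      have e12 : s2.nvar 12 = w := (hF2.nvar _ rfl).trans hw1
      by_cases hA : A w p
      · have hA' : (Test.adj 12 13).Holds s2 := by
          rw [Test.holds_adj h2 (by omega) (by omega), e12, hp2]; exact hA
        refine (Halts.ite_of_pos hA' (Halts.forUp_const 80 (fun j s' => HitReach n A d r t
          (fun v w' p' => w' < w ∨ w' = w ∧ (p' < p ∨ p' = p ∧ v < j)) (s'.rarr 2) (s'.narr 4))
          h2.size rfl rfl (by decide) (by simpa using hI2) ?_)).mono ?_ ?_
        · intro v hv s3 hF3 hv3 hI3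
          refine hitRelax_halts hd (h2.frame hF3 rfl) ?_ hI3 ((hF3.nvar _ rfl).trans e12)
            ((hF3.nvar _ rfl).trans hp2) hv3 hw hp hv hA ?_
          · rw [hF3.rarr _ rfl, hF2.rarr _ rfl, hF1.rarr _ rfl, hr]
          · intro a b c; omega
        · simp [hA, Test.adj, Test.cost, NExp.cost, NExp.entry]
        · rintro s3 ⟨hI3, -⟩
          refine HitReach.mono hI3 fun v hv a ha b hb _ hab => ?_
          omega
      · have hA' : ¬ (Test.adj 12 13).Holds s2 := by
          rw [Test.holds_adj h2 (by omega) (by omega), e12, hp2]; exact hA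
        refine (Halts.ite_of_neg (Q := fun s => s = s2) hA' (Halts.of_loopFree rfl rfl)).mono ?_ ?_
        · simp [hA, Test.adj, Test.cost, NExp.cost, NExp.entry, Prog.maxCost]
        · rintro s3 rfl
          refine HitReach.mono hI2 fun v hv a ha b hb hA1 hab => ?_
          rcases hab with hab | ⟨rfl, hab⟩
          · exact .inl hab
          · have : b ≠ p := by rintro rfl; exact hA hA1
            omega
    · rw [dartCount, Finset.sum_mul]
      simp only [Finset.sum_add_distrib, Finset.sum_const, Finset.card_range, smul_eq_mul]
      omega
    · rintro s3 ⟨hI3, -⟩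
      refine HitReach.mono hI3 fun v hv a ha b hb _ hab => ?_
      beta_reduce at hab
      omega
  · rintro s1 ⟨hI1, -⟩ v hv
    obtain ⟨h1, h2, h3⟩ := hI1 v hv
    refine ⟨h1, fun w hw hdw => ?_, fun w _ p _ _ _ _ h => h.elim⟩
    by_cases hwv : w = v
    · subst hwv; exact h1.self.2
    -- The dart from `w` to its parent has been handled in this pass, after the parent's label was
    -- set.
    · obtain ⟨p, hp, hA, hdp⟩ := hd.parent v hv w hw hwv
      exact h3 w hw p hp hA hdp (by omega) hw

theorem hitPhase_halts {d : ℕ → ℕ → ℕ} (hd : IsTreeDist n A d) {s : State}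
    (h : HasInput n A α q s) (hb : s.narr 4 = fun _ => 0) :
    Halts hitPhase s
      (n * 30 + 6 + (n * (((∑ w ∈ Finset.range n,
        (n * 20 + dartCount n A w * (n * 88 + 6) + 6 + 8)) + 6) + 8) + 6))
      (fun s' => ∀ v < n, HitInv n A d (s.rarr 1) (s'.rarr 2) (s'.narr 4) v ∧
        ∀ w < n, s'.narr 4 (v * n + w) ≠ 0) := by
  refine (hitInit_halts h hb hd (r := s.rarr 1)).frame.seq ?_
  rintro s1 ⟨hI1, hF1⟩
  have h1 := h.frame hF1 rfl
  refine (Halts.forUp_const _ (fun t s' => HitReach n A d (s.rarr 1) t (fun _ _ _ => False)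
    (s'.rarr 2) (s'.narr 4)) h1.size rfl rfl (by decide) ?_ ?_).mono le_rfl ?_
  · intro v hv
    refine ⟨hI1 v hv, fun w hw hdw => ?_, fun w _ p _ _ _ _ h => h.elim⟩
    by_cases hwv : w = v
    · subst hwv; exact (hI1 w hw).self.2
    · obtain ⟨p, -, -, hdp⟩ := hd.parent v hv w hw hwv
      omega
  · intro t ht s2 hF2 ht2 hI2
    exact hitRound_halts hd (h1.frame hF2 rfl) ((hF2.rarr _ rfl).trans (hF1.rarr _ rfl)) hI2
  · rintro s2 ⟨hI2, -⟩ v hv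
    exact ⟨(hI2 v hv).1, fun w hw => (hI2 v hv).2.1 w hw (hd.lt v hv w hw).le⟩

end Hit

/-! ### Third phase: the players -/

/-- Clears the inflows. -/
def clearInflow : Prog := .forUp 12 (.putR 4 (.var 12) .zero)

/-- Sums up the discounted mass that reaches the player in the integer variable `11`. -/
def massLoop : Prog :=
  .forUp 12 (.setR 2 (.add (.var 2) (.mul (.get 0 (.var 12)) (.get 2 (.entry 11 12)))))

/-- Sums up over the neighbours of the player in the integer variable `11`. -/
def degreeLoop : Prog :=
  .forUp 12 (.ite (.adj 11 12)
    (.seq (.setR 3 (.add (.var 3) .one))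
      (.setR 4 (.add (.var 4) (.sub .one (.mul (.sub .one (.var 0)) (.get 2 (.entry 11 12)))))))
    .skip)

/-- Sums up the inflows of the player in the integer variable `11`. -/
def inflowLoop : Prog :=
  .forUp 12 (.ite (.ne 12 11)
    (.putR 4 (.sub (.get 4 (.entry 11 12)) (.const 1))
      (.add (.get 4 (.sub (.get 4 (.entry 11 12)) (.const 1)))
        (.mul (.get 0 (.var 12)) (.get 2 (.entry 11 12)))))
    .skip)

/-- Computes the weights for no outlinks. -/
def weightInit : Prog :=
  .forUp 12 (.putR 3 (.var 12)
    (.sub (.mul (.mul (.var 5) (.sub .one (.var 0))) (.get 2 (.entry 11 12)))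
      (.sub (.var 5) (.get 0 (.var 11)))))

/-- Counts the non-neighbours that precede the node in the integer variable `12`. -/
def nonRankLoop : Prog :=
  .forUp 13 (.ite (.and (.not (.adj 11 12)) (.and (.not (.adj 11 13))
      (.and (.ne 13 11) (.beats 13 12))))
    (.setN 20 (.add (.var 20) (.const 1))) .skip)

/-- Ranks the non-neighbours. -/
def nonRankPhase : Prog :=
  .forUp 12 (.seq (.setN 20 (.const 0)) (.seq nonRankLoop (.putN 5 (.var 12) (.var 20))))

/-- The preparations for the player in the integer variable `11`. -/
def playerInit : Prog :=
  .seq clearInflow (.seq inflowLoop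
    (.seq (.seq (.setR 2 .zero) (.seq (.setR 3 .zero) (.setR 4 .zero)))
      (.seq massLoop (.seq degreeLoop
        (.seq (.setR 5 (.div (.mul (.var 2) (.var 3)) (.var 4)))
          (.seq weightInit nonRankPhase))))))

section Player

variable {n : ℕ} {A : ℕ → ℕ → Prop} {α : ℝ} {q : ℕ → ℝ}

/-- The computed inflow of the player `v` through `u`. -/
noncomputable def inflowVal (n : ℕ) (q f : ℕ → ℝ) (b : ℕ → ℕ) (v u : ℕ) : ℝ :=
  ∑ w ∈ Finset.range n, if w ≠ v ∧ b (v * n + w) - 1 = u then q w * f (v * n + w) else 0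

open Classical in
/-- The computed scaled PageRank of the player `v`. -/
noncomputable def baseVal (n : ℕ) (A : ℕ → ℕ → Prop) (α : ℝ) (q f : ℕ → ℝ) (v : ℕ) : ℝ :=
  (∑ w ∈ Finset.range n, q w * f (v * n + w)) *
    (∑ w ∈ Finset.range n, if A v w then (1 : ℝ) else 0) /
    ∑ w ∈ Finset.range n, if A v w then 1 - (1 - α) * f (v * n + w) else 0

/-- The computed weight of the node `w` for the player `v` with `k` outlinks. -/
noncomputable def weightVal (n : ℕ) (A : ℕ → ℕ → Prop) (α : ℝ) (q f : ℕ → ℝ) (b : ℕ → ℕ)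
    (v k w : ℕ) : ℝ :=
  baseVal n A α q f v * (1 - α) * f (v * n + w) - (baseVal n A α q f v - q v)
    + k * inflowVal n q f b v w

open Classical in
/-- The number of non-neighbours that precede the non-neighbour `w`. -/
noncomputable def nonRank (n : ℕ) (A : ℕ → ℕ → Prop) (g : ℕ → ℝ) (v w : ℕ) : ℕ :=
  ∑ y ∈ Finset.range n, if ¬ A v w ∧ ¬ A v y ∧ y ≠ v ∧ Beats g y w then 1 else 0

open Classical in
/-- The number of other nodes that precede `w`. -/
noncomputable def fullRank (n : ℕ) (g : ℕ → ℝ) (v w : ℕ) : ℕ :=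
  ∑ y ∈ Finset.range n, if y ≠ v ∧ Beats g y w then 1 else 0

theorem Beats.congr {ι : Type*} [LinearOrder ι] {g g' : ι → ℝ} {x y : ι} (hx : g x = g' x)
    (hy : g y = g' y) : Beats g x y ↔ Beats g' x y := by
  rw [Beats, Beats, hx, hy]

/-- Only weights of non-neighbours matter, so ranks computed for `k = 0` stay valid for all `k`. -/
theorem nonRank_congr {g g' : ℕ → ℝ} {v w : ℕ} (hw : w < n)
    (h : ∀ y < n, ¬ A v y → g y = g' y) : nonRank n A g v w = nonRank n A g' v w := by
  classical
  refine Finset.sum_congr rfl fun y hy => if_congr ?_ rfl rfl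
  refine and_congr_right fun h1 => and_congr_right fun h2 => and_congr_right fun _ => ?_
  exact Beats.congr (h y (Finset.mem_range.1 hy) h2) (h w hw h1)

theorem fullRank_congr {g g' : ℕ → ℝ} {v w : ℕ} (hw : w < n)
    (h : ∀ y < n, g y = g' y) : fullRank n g v w = fullRank n g' v w := by
  classical
  refine Finset.sum_congr rfl fun y hy => if_congr ?_ rfl rfl
  exact and_congr_right fun _ => Beats.congr (h y (Finset.mem_range.1 hy)) (h w hw)

theorem clearInflow_halts {s : State} (h : HasInput n A α q s) :
    Halts clearInflow s (n * 20 + 6) (fun s' => ∀ u < n, s'.rarr 4 u = 0) := by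
  refine (Halts.forUp_const 12 (fun j s' => ∀ u < j, s'.rarr 4 u = 0) h.size rfl rfl (by decide)
    (by simp) ?_).mono le_rfl (fun _ h => h.1)
  intro j hj s' hF hj' hI
  refine (Halts.of_loopFree rfl ?_).mono (by decide) (fun _ h => h)
  intro u hu
  simp only [Prog.exec, NExp.eval, RExp.eval, State.withN_rarr, Function.update_self, hj',
    Function.update_apply]
  split_ifs
  · rfl
  · exact hI u (by omega)

/-- Each node adds its mass to the entry of its own branch, decoded as label minus one, so a single
pass yields the inflows through all nodes. -/
theorem inflowLoop_halts {s : State} (h : HasInput n A α q s) {v : ℕ} (hv : s.nvar 11 = v)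
    (hvn : v < n) (hr : ∀ u < n, s.rarr 4 u = 0) :
    Halts inflowLoop s (n * 60 + 6) (fun s' =>
      ∀ u < n, s'.rarr 4 u = inflowVal n q (s.rarr 2) (s.narr 4) v u) := by
  refine (Halts.forUp_const 52 (fun j s' =>
      ∀ u < n, s'.rarr 4 u = ∑ w ∈ Finset.range j,
        if w ≠ v ∧ s.narr 4 (v * n + w) - 1 = u then q w * s.rarr 2 (v * n + w) else 0)
    h.size rfl rfl (by decide) (by simpa using hr) ?_).mono le_rfl (fun _ h => h.1)
  rintro j hj s1 hF hj1 ir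
  have h1 := h.frame hF rfl
  have e11 : s1.nvar 11 = v := (hF.nvar _ rfl).trans hv
  have er : s1.rarr 2 = s.rarr 2 := hF.rarr _ rfl
  have en : s1.narr 4 = s.narr 4 := hF.narr _ rfl
  have eb := h1.row v hvn
  refine (Halts.of_loopFree rfl ?_).mono (by decide) (fun _ h => h)
  intro u hu
  rw [Finset.sum_range_succ, ← ir u hu]
  simp only [Prog.exec, State.withN_rarr, Test.holds_ne, NExp.entry, NExp.eval, RExp.eval,
    e11, hj1, eb, er, en, h1.jump]
  by_cases hjv : j = v
  · simp [hjv]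
  · by_cases hu : s.narr 4 (v * n + j) - 1 = u
    · simp [hjv, hu]
    · simp [hjv, hu, Ne.symm hu]

theorem massLoop_halts {s : State} (h : HasInput n A α q s) {v : ℕ} (hv : s.nvar 11 = v)
    (hvn : v < n) (h2 : s.rvar 2 = 0) :
    Halts massLoop s (n * 30 + 6) (fun s' =>
      s'.rvar 2 = ∑ w ∈ Finset.range n, q w * s.rarr 2 (v * n + w)) := by
  refine (Halts.forUp_const 22 (fun j s' =>
      s'.rvar 2 = ∑ w ∈ Finset.range j, q w * s.rarr 2 (v * n + w))
    h.size rfl rfl (by decide) (by simpa using h2) ?_).mono le_rfl (fun _ h => h.1)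
  rintro j hj s1 hF hj1 i2
  have h1 := h.frame hF rfl
  have e11 : s1.nvar 11 = v := (hF.nvar _ rfl).trans hv
  have er : s1.rarr 2 = s.rarr 2 := hF.rarr _ rfl
  refine (Halts.of_loopFree rfl ?_).mono (by decide) (fun _ h => h)
  simp [Prog.exec, NExp.entry, NExp.eval, RExp.eval, e11, hj1, h1.row v hvn, er, h1.jump, i2,
    Finset.sum_range_succ]

open Classical in
theorem degreeLoop_halts {s : State} (h : HasInput n A α q s) {v : ℕ} (hv : s.nvar 11 = v)
    (hvn : v < n) (h3 : s.rvar 3 = 0) (h4 : s.rvar 4 = 0) :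
    Halts degreeLoop s (n * 60 + 6) (fun s' =>
      s'.rvar 3 = ∑ w ∈ Finset.range n, (if A v w then (1 : ℝ) else 0) ∧
      s'.rvar 4 = ∑ w ∈ Finset.range n,
        (if A v w then 1 - (1 - α) * s.rarr 2 (v * n + w) else 0)) := by
  refine (Halts.forUp_const 52 (fun j s' =>
      s'.rvar 3 = ∑ w ∈ Finset.range j, (if A v w then (1 : ℝ) else 0) ∧
      s'.rvar 4 = ∑ w ∈ Finset.range j,
        (if A v w then 1 - (1 - α) * s.rarr 2 (v * n + w) else 0))
    h.size rfl rfl (by decide) (by simp [h3, h4]) ?_).mono le_rfl (fun _ h => h.1)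
  rintro j hj s1 hF hj1 ⟨i3, i4⟩
  have h1 := h.frame hF rfl
  have e11 : s1.nvar 11 = v := (hF.nvar _ rfl).trans hv
  have er : s1.rarr 2 = s.rarr 2 := hF.rarr _ rfl
  refine (Halts.of_loopFree rfl ?_).mono (by decide) (fun _ h => h)
  simp only [Prog.exec, State.withN_rvar, Test.holds_adj h1 (show s1.nvar 11 < n by omega)
    (show s1.nvar 12 < n by omega), e11, hj1, Finset.sum_range_succ, ← i3, ← i4]
  by_cases hA : A v j <;>
    simp [hA, NExp.entry, NExp.eval, RExp.eval, e11, hj1, h1.row v hvn, er, h1.damp]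

theorem weightInit_halts {s : State} (h : HasInput n A α q s) {v : ℕ} (hv : s.nvar 11 = v)
    (hvn : v < n) (h5 : s.rvar 5 = baseVal n A α q (s.rarr 2) v) (b : ℕ → ℕ) :
    Halts weightInit s (n * 30 + 6) (fun s' =>
      ∀ w < n, s'.rarr 3 w = weightVal n A α q (s.rarr 2) b v 0 w) := by
  refine (Halts.forUp_const 22 (fun j s' =>
      ∀ w < j, s'.rarr 3 w = weightVal n A α q (s.rarr 2) b v 0 w)
    h.size rfl rfl (by decide) (by simp) ?_).mono le_rfl (fun _ h => h.1)
  rintro j hj s1 hF hj1 hI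
  have h1 := h.frame hF rfl
  have e11 : s1.nvar 11 = v := (hF.nvar _ rfl).trans hv
  have er : s1.rarr 2 = s.rarr 2 := hF.rarr _ rfl
  have e5 : s1.rvar 5 = _ := (hF.rvar _ rfl).trans h5
  refine (Halts.of_loopFree rfl ?_).mono (by decide) (fun _ h => h)
  intro w hw
  simp only [Prog.exec, State.withN_rarr, Function.update_self, Function.update_apply, NExp.entry,
    NExp.eval, RExp.eval, e11, hj1, h1.row v hvn, er, h1.damp, h1.jump, e5]
  split_ifs with hwj
  · simp [weightVal, hwj]
  · exact hI w (by omega)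

open Classical in
-- The quadratic cost is affordable because this runs once per player and not once per number of
-- outlinks.
theorem nonRankPhase_halts {s : State} (h : HasInput n A α q s) {v : ℕ} (hv : s.nvar 11 = v)
    (hvn : v < n) :
    Halts nonRankPhase s (n * (n * 100 + 30) + 6) (fun s' =>
      ∀ w < n, s'.narr 5 w = nonRank n A (s.rarr 3) v w) := by
  refine (Halts.forUp_const (n * 100 + 22) (fun j s' =>
      ∀ w < j, s'.narr 5 w = nonRank n A (s.rarr 3) v w)
    h.size rfl rfl (by decide) (by simp) ?_).mono le_rfl (fun _ h => h.1)
  rintro w hw s1 hF1 hw1 hI1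
  have h1 := h.frame hF1 rfl
  have e11 : s1.nvar 11 = v := (hF1.nvar _ rfl).trans hv
  have e3 : s1.rarr 3 = s.rarr 3 := hF1.rarr _ rfl
  refine ((Halts.of_loopFree (Q := fun s' => s' = (Prog.setN 20 (.const 0)).exec s1) rfl rfl).seq
    (C := n * 100 + 20) ?_).mono (by simp [Prog.maxCost, NExp.cost]; omega) (fun _ h => h)
  rintro s2 rfl
  have hF2 : Frame (.setN 20 (.const 0)) s1 ((Prog.setN 20 (.const 0)).exec s1) :=
    (Runs.setN s1 20 (.const 0)).frame
  have h2 := h1.frame hF2 rfl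
  have z2 : ((Prog.setN 20 (.const 0)).exec s1).nvar 20 = 0 := by simp [Prog.exec, NExp.eval]
  set s2 := (Prog.setN 20 (.const 0)).exec s1
  refine ((Halts.forUp_const 92 (fun j s' => s'.nvar 20 = ∑ y ∈ Finset.range j,
      if ¬ A v w ∧ ¬ A v y ∧ y ≠ v ∧ Beats (s.rarr 3) y w then 1 else 0)
    h2.size rfl rfl (by decide) (by simpa using z2) ?_).seq (C := 10) ?_).mono (by omega)
    (fun _ h => h)
  · intro y hy s3 hF3 hy3 hI3
    have h3 := h2.frame hF3 rfl
    have e11' : s3.nvar 11 = v := ((hF3.nvar _ rfl).trans (hF2.nvar _ rfl)).trans e11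
    have e12' : s3.nvar 12 = w := ((hF3.nvar _ rfl).trans (hF2.nvar _ rfl)).trans hw1
    have e3' : s3.rarr 3 = s.rarr 3 := ((hF3.rarr _ rfl).trans (hF2.rarr _ rfl)).trans e3
    refine (Halts.of_loopFree rfl ?_).mono (by decide) (fun _ h => h)
    simp only [Prog.exec, Test.Holds, Test.holds_ne, Test.holds_beats,
      Test.holds_adj h3 (show s3.nvar 11 < n by omega) (show s3.nvar 12 < n by omega),
      Test.holds_adj h3 (show s3.nvar 11 < n by omega) (show s3.nvar 13 < n by omega),
      e11', e12', hy3, e3', NExp.eval, Finset.sum_range_succ, ← hI3]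
    split_ifs <;> simp
  · rintro s3 ⟨hI3, hF3⟩
    have e12' : s3.nvar 12 = w := ((hF3.nvar _ rfl).trans (hF2.nvar _ rfl)).trans hw1
    have e5' : s3.narr 5 = s1.narr 5 := (hF3.narr _ rfl).trans (hF2.narr _ rfl)
    refine (Halts.of_loopFree rfl ?_).mono (by decide) (fun _ h => h)
    intro x hx
    simp only [Prog.exec, NExp.eval, State.withN_narr, Function.update_self, e12', e5',
      Function.update_apply, hI3]
    split_ifs with hxw
    · rw [hxw, nonRank]
    · exact hI1 x (by omega)

theorem playerInit_halts {s : State} (h : HasInput n A α q s) {v : ℕ} (hv : s.nvar 11 = v)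
    (hvn : v < n) :
    Halts playerInit s (n * (n * 100 + 230) + 70) (fun s' =>
      (∀ w < n, s'.rarr 3 w = weightVal n A α q (s.rarr 2) (s.narr 4) v 0 w) ∧
      (∀ w < n, s'.rarr 4 w = inflowVal n q (s.rarr 2) (s.narr 4) v w) ∧
      ∀ w < n, s'.narr 5 w
        = nonRank n A (weightVal n A α q (s.rarr 2) (s.narr 4) v 0) v w) := by
  classical
  refine (Halts.seq (clearInflow_halts h).frame
    (C := n * 60 + 6 + (7 + (n * 30 + 6 + (n * 60 + 6 + (10 + (n * 30 + 6 +
      (n * (n * 100 + 30) + 6))))))) ?_).mono (by ring_nf; omega) (fun _ h => h)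
  rintro s1 ⟨q1, F1⟩
  have h1 := h.frame F1 rfl
  have v1 : s1.nvar 11 = v := (F1.nvar _ rfl).trans hv
  have a1 : s1.rarr 2 = s.rarr 2 := F1.rarr _ rfl
  have b1 : s1.narr 4 = s.narr 4 := F1.narr _ rfl
  refine (inflowLoop_halts h1 v1 hvn q1).frame.seq ?_
  rintro s2 ⟨q2, F2⟩
  rw [a1, b1] at q2
  have h2 := h1.frame F2 rfl
  have v2 : s2.nvar 11 = v := (F2.nvar _ rfl).trans v1
  have a2 : s2.rarr 2 = s.rarr 2 := (F2.rarr _ rfl).trans a1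
  refine Halts.seq ((Halts.of_loopFree (Q := fun s' => s'.rvar 2 = 0 ∧ s'.rvar 3 = 0 ∧ s'.rvar 4 = 0)
    rfl (by simp [Prog.exec, RExp.eval])).frame.mono (by decide) (fun _ h => h)) ?_
  rintro s3 ⟨⟨z2, z3, z4⟩, F3⟩
  have h3 := h2.frame F3 rfl
  have v3 : s3.nvar 11 = v := (F3.nvar _ rfl).trans v2
  have a3 : s3.rarr 2 = s.rarr 2 := (F3.rarr _ rfl).trans a2
  have c3 : s3.rarr 4 = s2.rarr 4 := F3.rarr _ rfl
  refine (massLoop_halts h3 v3 hvn z2).frame.seq ?_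
  rintro s4 ⟨q4, F4⟩
  have h4 := h3.frame F4 rfl
  have v4 : s4.nvar 11 = v := (F4.nvar _ rfl).trans v3
  have a4 : s4.rarr 2 = s.rarr 2 := (F4.rarr _ rfl).trans a3
  have c4 : s4.rarr 4 = s2.rarr 4 := (F4.rarr _ rfl).trans c3
  refine (degreeLoop_halts h4 v4 hvn ((F4.rvar _ rfl).trans z3)
    ((F4.rvar _ rfl).trans z4)).frame.seq ?_
  rintro s5 ⟨⟨q5, q5'⟩, F5⟩
  have h5 := h4.frame F5 rfl
  have v5 : s5.nvar 11 = v := (F5.nvar _ rfl).trans v4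
  have a5 : s5.rarr 2 = s.rarr 2 := (F5.rarr _ rfl).trans a4
  have c5 : s5.rarr 4 = s2.rarr 4 := (F5.rarr _ rfl).trans c4
  rw [a3] at q4
  rw [a4] at q5'
  have q4' : s5.rvar 2 = _ := (F5.rvar _ rfl).trans q4
  refine Halts.seq ((Halts.of_loopFree (Q := fun s' => s'.rvar 5 = baseVal n A α q (s.rarr 2) v)
    rfl (by simp [Prog.exec, RExp.eval, q4', q5, q5', baseVal])).frame.mono (by decide)
    (fun _ h => h)) ?_
  rintro s6 ⟨q6, F6⟩
  have h6 := h5.frame F6 rfl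
  have v6 : s6.nvar 11 = v := (F6.nvar _ rfl).trans v5
  have a6 : s6.rarr 2 = s.rarr 2 := (F6.rarr _ rfl).trans a5
  have c6 : s6.rarr 4 = s2.rarr 4 := (F6.rarr _ rfl).trans c5
  refine (weightInit_halts h6 v6 hvn (by rw [q6, a6]) (s.narr 4)).frame.seq ?_
  rintro s7 ⟨q7, F7⟩
  rw [a6] at q7
  have h7 := h6.frame F7 rfl
  have v7 : s7.nvar 11 = v := (F7.nvar _ rfl).trans v6
  have c7 : s7.rarr 4 = s2.rarr 4 := (F7.rarr _ rfl).trans c6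
  refine (nonRankPhase_halts h7 v7 hvn).frame.mono le_rfl ?_
  rintro s8 ⟨q8, F8⟩
  refine ⟨fun w hw => ?_, fun w hw => ?_, fun w hw => ?_⟩
  · rw [F8.rarr 3 rfl]; exact q7 w hw
  · rw [F8.rarr 4 rfl, c7]; exact q2 w hw
  · rw [q8 w hw]
    exact nonRank_congr hw fun y hy _ => q7 y hy

end Player

/-! ### Testing the best strategy of a player for each number of outlinks -/

/-- Starts the ranks with the numbers of preceding non-neighbours. -/
def rankCopy : Prog := .forUp 13 (.putN 6 (.var 13) (.get 5 (.var 13)))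

/-- Compares the neighbour in the integer variable `13` with all nodes. -/
def rankCompare : Prog :=
  .forUp 14 (.ite (.ne 14 11)
    (.ite (.beats 14 13) (.putN 6 (.var 13) (.add (.get 6 (.var 13)) (.const 1)))
      (.ite (.adj 11 14) .skip (.putN 6 (.var 14) (.add (.get 6 (.var 14)) (.const 1)))))
    .skip)

/-- Computes the ranks of all nodes. -/
def rankPhase : Prog := .seq rankCopy (.forUp 13 (.ite (.adj 11 13) rankCompare .skip))

/-- The node in the integer variable `13` is among the selected ones. -/
def Test.selected : Test := .and (.ne 13 11) (.nlt (.get 6 (.var 13)) (.var 12))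

/-- Sums up the weights of the selected nodes. -/
def surplusLoop : Prog :=
  .forUp 13 (.ite .selected (.setR 6 (.add (.var 6) (.get 3 (.var 13)))) .skip)

/-- Writes the selected nodes to the output. -/
def outputLoop : Prog :=
  .forUp 13 (.seq (.putN 1 (.var 13) (.const 0)) (.seq (.putN 2 (.var 13) (.const 0))
    (.ite .selected (.ite (.adj 11 13) (.putN 1 (.var 13) (.const 1))
      (.putN 2 (.var 13) (.const 1))) .skip)))

/-- Adds the inflows to the weights. -/
def weightStep : Prog :=
  .forUp 13 (.putR 3 (.var 13) (.add (.get 3 (.var 13)) (.get 4 (.var 13))))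

/-- Tests the best strategy of the player in the integer variable `11` whose number of outlinks is
in the integer variable `12`. -/
def playerRound : Prog :=
  .seq rankPhase (.seq (.setR 6 .zero) (.seq surplusLoop
    (.seq (.ite (.rlt .zero (.var 6))
        (.seq (.seq (.setN 0 (.const 0)) (.setN 1 (.var 11))) outputLoop) .skip)
      weightStep)))

/-- Tests all players. -/
def playerPhase : Prog := .forUp 11 (.seq playerInit (.forUp 12 playerRound))

section Round

variable {n : ℕ} {A : ℕ → ℕ → Prop} {α : ℝ} {q : ℕ → ℝ}

open Classical in
-- One pass for a neighbour `u` completes the rank of `u` itself and adds its contribution to the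
-- rank of each non-neighbour that it precedes. Other neighbours are left alone, as they get passes
-- of their own.
theorem rankCompare_halts {s : State} (h : HasInput n A α q s) {v u : ℕ} (hv : s.nvar 11 = v)
    (hu : s.nvar 13 = u) (hvn : v < n) (hun : u < n) (hA : A v u) (hirr : ¬ A v v) :
    Halts rankCompare s (n * 100 + 6) (fun s' => ∀ w < n, w ≠ v → s'.narr 6 w = s.narr 6 w +
      if w = u then fullRank n (s.rarr 3) v u
      else if ¬ A v w ∧ Beats (s.rarr 3) u w then 1 else 0) := by
  have huv : u ≠ v := by rintro rfl; exact hirr hA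
  refine (Halts.forUp_const 92 (fun j s' => ∀ w < n, w ≠ v → s'.narr 6 w = s.narr 6 w +
      if w = u then ∑ y ∈ Finset.range j, (if y ≠ v ∧ Beats (s.rarr 3) y u then 1 else 0)
      else if w < j ∧ ¬ A v w ∧ Beats (s.rarr 3) u w then 1 else 0)
    h.size rfl rfl (by decide) (by simp) ?_).mono le_rfl ?_
  · intro y hy s1 hF hy1 hI
    have h1 := h.frame hF rfl
    have e11 : s1.nvar 11 = v := (hF.nvar _ rfl).trans hv
    have e13 : s1.nvar 13 = u := (hF.nvar _ rfl).trans hu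
    have e3 : s1.rarr 3 = s.rarr 3 := hF.rarr _ rfl
    refine (Halts.of_loopFree rfl ?_).mono (by decide) (fun _ h => h)
    intro w hw hwv
    have hI' := hI w hw hwv
    have hlt : w < y + 1 ↔ w < y ∨ w = y := by omega
    rw [Finset.sum_range_succ]
    simp only [hlt, Prog.exec, State.withN_narr, Test.holds_ne, Test.holds_beats,
      Test.holds_adj h1 (show s1.nvar 11 < n by omega) (show s1.nvar 14 < n by omega),
      e11, e13, hy1, e3, NExp.eval]
    have hirrB : ¬ Beats (s.rarr 3) u u := irrefl_of (Beats (s.rarr 3)) u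
    by_cases hyv : y = v
    · have hwy : w ≠ y := fun e => hwv (e.trans hyv)
      simp [hyv, hI', hwv]
    · by_cases hB : Beats (s.rarr 3) y u
      · have hB' : ¬ Beats (s.rarr 3) u y := asymm_of (Beats (s.rarr 3)) hB
        by_cases hwu : w = u
        · subst hwu
          simp [hyv, hB, hI', add_assoc]
        · have : w = y → ¬ Beats (s.rarr 3) u w := by rintro rfl; exact hB'
          simp only [hyv, hB, hwu, Function.update_apply, ne_eq, not_false_eq_true, if_true,
            if_false, and_self, hI']
          congr 1
          refine if_congr ?_ rfl rfl
          tauto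
      · by_cases hAy : A v y
        · have : w = y → A v w := by rintro rfl; exact hAy
          simp only [hyv, hB, hAy, ne_eq, not_false_eq_true, if_true, if_false, and_false, add_zero,
            hI']
          congr 1
          split_ifs <;> first | rfl | tauto
        · have hyu : y ≠ u := by rintro rfl; exact hAy hA
          -- The program tests one direction only; ties being broken by index, the other follows by
          -- totality.
          have hB' : Beats (s.rarr 3) u y := by
            rcases trichotomous_of (Beats (s.rarr 3)) u y with h2 | h2 | h2
            · exact h2
            · exact absurd h2.symm hyu
            · exact absurd h2 hB
          by_cases hwy : w = y
          · subst hwy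
            simp [hyv, hB, hAy, hyu, hI', hB']
          · simp [hyv, hB, hAy, hwy, hI']
  · rintro s1 ⟨hI, -⟩ w hw hwv
    rw [hI w hw hwv]
    simp only [hw, true_and, fullRank]

open Classical in
-- The pairs to be compared are split by type: pairs of non-neighbours come from the precomputed
-- ranks, all others involve a neighbour and are counted in its pass. This replaces sorting.
theorem rankPhase_halts {s : State} (h : HasInput n A α q s) {v : ℕ} (hv : s.nvar 11 = v)
    (hvn : v < n) (hirr : ¬ A v v)
    (h5 : ∀ w < n, s.narr 5 w = nonRank n A (s.rarr 3) v w) :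
    Halts rankPhase s (n * 50 + dartCount n A v * (n * 100 + 6) + 12) (fun s' =>
      ∀ w < n, w ≠ v → s'.narr 6 w = fullRank n (s.rarr 3) v w) := by
  have hcopy : Halts rankCopy s (n * 20 + 6) (fun s' => ∀ w < n, s'.narr 6 w = s.narr 5 w) := by
    refine (Halts.forUp_const 12 (fun j s' => ∀ w < j, s'.narr 6 w = s.narr 5 w) h.size rfl rfl
      (by decide) (by simp) ?_).mono le_rfl (fun _ h => h.1)
    intro j hj s1 hF hj1 hI
    have e5 : s1.narr 5 = s.narr 5 := hF.narr _ rfl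
    refine (Halts.of_loopFree rfl ?_).mono (by decide) (fun _ h => h)
    intro w hw
    simp only [Prog.exec, NExp.eval, State.withN_narr, Function.update_self, Function.update_apply,
      hj1, e5]
    split_ifs with hwj
    · rw [hwj]
    · exact hI w (by omega)
  refine (hcopy.frame.seq (C := (∑ u ∈ Finset.range n,
    ((12 + (if A v u then 1 else 0) * (n * 100 + 6)) + 8)) + 6) ?_).mono ?_ (fun _ h => h)
  · rintro s1 ⟨q1, F1⟩
    have h1 := h.frame F1 rfl
    have v1 : s1.nvar 11 = v := (F1.nvar _ rfl).trans hv
    have e3 : s1.rarr 3 = s.rarr 3 := F1.rarr _ rfl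
    refine (Halts.forUp (c := fun u => 12 + (if A v u then 1 else 0) * (n * 100 + 6))
      (fun j s' => ∀ w < n, w ≠ v → s'.narr 6 w = nonRank n A (s.rarr 3) v w +
      ∑ u ∈ Finset.range j, if A v u then
        (if w = u then fullRank n (s.rarr 3) v u
          else if ¬ A v w ∧ Beats (s.rarr 3) u w then 1 else 0) else 0)
      h1.size rfl rfl (by decide) ?_ ?_).mono le_rfl ?_
    · intro w hw hwv
      simp [q1 w hw, h5 w hw]
    · intro u hu s2 F2 hu2 hI2
      have h2 := h1.frame F2 rfl
      have v2 : s2.nvar 11 = v := (F2.nvar _ rfl).trans v1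
      have e3' : s2.rarr 3 = s.rarr 3 := (F2.rarr _ rfl).trans e3
      by_cases hA : A v u
      · have hA' : (Test.adj 11 13).Holds s2 := by
          rw [Test.holds_adj h2 (by omega) (by omega), v2, hu2]; exact hA
        refine (Halts.ite_of_pos hA' (rankCompare_halts h2 v2 hu2 hvn hu hA hirr)).mono ?_ ?_
        · simp [hA, Test.adj, Test.cost, NExp.cost, NExp.entry]
        · intro s3 hI3 w hw hwv
          rw [State.withN_narr, hI3 w hw hwv, hI2 w hw hwv, Finset.sum_range_succ, if_pos hA, e3',
            add_assoc]
      · have hA' : ¬ (Test.adj 11 13).Holds s2 := by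
          rw [Test.holds_adj h2 (by omega) (by omega), v2, hu2]; exact hA
        refine (Halts.ite_of_neg (Q := fun s => s = s2) hA' (Halts.of_loopFree rfl rfl)).mono ?_ ?_
        · simp [hA, Test.adj, Test.cost, NExp.cost, NExp.entry, Prog.maxCost]
        · rintro s3 rfl w hw hwv
          rw [State.withN_narr, hI2 w hw hwv, Finset.sum_range_succ, if_neg hA, add_zero]
    · rintro s2 ⟨hI2, -⟩ w hw hwv
      rw [hI2 w hw hwv]
      by_cases hA : A v w
      -- A neighbour starts from 0, and its rank comes entirely from its own pass.
      · rw [nonRank, Finset.sum_eq_zero (fun y _ => if_neg fun h => h.1 hA), zero_add,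
          Finset.sum_eq_single w]
        · simp [hA]
        · intro u _ huw
          simp [huw.symm, hA]
        · intro h; exact absurd (Finset.mem_range.2 hw) h
      · rw [nonRank, ← Finset.sum_add_distrib, fullRank]
        refine Finset.sum_congr rfl fun y _ => ?_
        by_cases hAy : A v y
        · have h1 : y ≠ v := by rintro rfl; exact hirr hAy
          have h2 : w ≠ y := by rintro rfl; exact hA hAy
          simp [hA, hAy, h1, h2]
        · simp [hA, hAy]
  · rw [dartCount, Finset.sum_mul]
    simp only [Finset.sum_add_distrib, Finset.sum_const, Finset.card_range, smul_eq_mul]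
    omega

/-- The node `w` is among the `k` best other nodes for `v`. -/
def Selected (n : ℕ) (g : ℕ → ℝ) (v k w : ℕ) : Prop := w ≠ v ∧ fullRank n g v w < k

open Classical in
/-- The total weight of the `k` best other nodes for `v`. -/
noncomputable def surplus (n : ℕ) (g : ℕ → ℝ) (v k : ℕ) : ℝ :=
  ∑ w ∈ Finset.range n, if Selected n g v k w then g w else 0

theorem selected_congr {g g' : ℕ → ℝ} {v k w : ℕ} (hw : w < n) (h : ∀ y < n, g y = g' y) :
    Selected n g v k w ↔ Selected n g' v k w := by
  rw [Selected, Selected, fullRank_congr hw h]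

theorem surplus_congr {g g' : ℕ → ℝ} {v k : ℕ} (h : ∀ y < n, g y = g' y) :
    surplus n g v k = surplus n g' v k := by
  classical
  refine Finset.sum_congr rfl fun w hw => ?_
  rw [h w (Finset.mem_range.1 hw)]
  exact if_congr (selected_congr (Finset.mem_range.1 hw) h) rfl rfl

theorem holds_selected {s : State} {g : ℕ → ℝ} {v k w : ℕ} (hv : s.nvar 11 = v)
    (hk : s.nvar 12 = k) (hw : s.nvar 13 = w)
    (h6 : w ≠ v → s.narr 6 w = fullRank n g v w) :
    Test.selected.Holds s ↔ Selected n g v k w := by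
  simp only [Test.selected, Test.Holds, Test.holds_ne, NExp.eval, hv, hk, hw, Selected]
  exact and_congr_right fun h => by rw [h6 h]

open Classical in
theorem surplusLoop_halts {s : State} (h : HasInput n A α q s) {v k : ℕ} (hv : s.nvar 11 = v)
    (hk : s.nvar 12 = k) (z6 : s.rvar 6 = 0)
    (h6 : ∀ w < n, w ≠ v → s.narr 6 w = fullRank n (s.rarr 3) v w) :
    Halts surplusLoop s (n * 40 + 6) (fun s' => s'.rvar 6 = surplus n (s.rarr 3) v k) := by
  refine (Halts.forUp_const 32 (fun j s' => s'.rvar 6 = ∑ w ∈ Finset.range j,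
      if Selected n (s.rarr 3) v k w then s.rarr 3 w else 0)
    h.size rfl rfl (by decide) (by simpa using z6) ?_).mono le_rfl (fun _ h => h.1)
  intro j hj s1 hF hj1 hI
  have e3 : s1.rarr 3 = s.rarr 3 := hF.rarr _ rfl
  have hs : Test.selected.Holds s1 ↔ Selected n (s.rarr 3) v k j :=
    holds_selected ((hF.nvar _ rfl).trans hv) ((hF.nvar _ rfl).trans hk) hj1
      (fun hjv => by rw [hF.narr 6 rfl]; exact h6 j hj hjv)
  refine (Halts.of_loopFree rfl ?_).mono (by decide) (fun _ h => h)
  simp only [Prog.exec, hs, RExp.eval, NExp.eval, hj1, e3, Finset.sum_range_succ, ← hI]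
  split_ifs <;> simp

theorem outputLoop_halts {s : State} (h : HasInput n A α q s) {g : ℕ → ℝ} {v k : ℕ}
    (hv : s.nvar 11 = v) (hk : s.nvar 12 = k) (hvn : v < n)
    (h6 : ∀ w < n, w ≠ v → s.narr 6 w = fullRank n g v w) :
    Halts outputLoop s (n * 60 + 6) (fun s' => ∀ w < n,
      (s'.narr 1 w = 1 ↔ Selected n g v k w ∧ A v w) ∧
      (s'.narr 2 w = 1 ↔ Selected n g v k w ∧ ¬ A v w)) := by
  classical
  refine (Halts.forUp_const 52 (fun j s' => ∀ w < j,
      (s'.narr 1 w = 1 ↔ Selected n g v k w ∧ A v w) ∧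
      (s'.narr 2 w = 1 ↔ Selected n g v k w ∧ ¬ A v w))
    h.size rfl rfl (by decide) (by simp) ?_).mono le_rfl (fun _ h => h.1)
  intro j hj s1 hF hj1 hI
  have h1 := h.frame hF rfl
  have v1 : s1.nvar 11 = v := (hF.nvar _ rfl).trans hv
  refine Halts.mono (B := 4 + (4 + 44)) ?_ (by omega) (fun _ h => h)
  -- Cleared because an earlier successful round may have left its marks here.
  have clear1 : Halts (.putN 1 (.var 13) (.const 0)) s1 4
      (fun s' => s'.narr 1 = Function.update (s1.narr 1) j 0) :=
    (Halts.of_loopFree rfl (by simp [Prog.exec, NExp.eval, hj1])).mono (by decide) (fun _ h => h)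
  refine clear1.frame.seq ?_
  rintro s2 ⟨q2, F2⟩
  have j2 : s2.nvar 13 = j := (F2.nvar _ rfl).trans hj1
  have clear2 : Halts (.putN 2 (.var 13) (.const 0)) s2 4
      (fun s' => s'.narr 2 = Function.update (s2.narr 2) j 0) :=
    (Halts.of_loopFree rfl (by simp [Prog.exec, NExp.eval, j2])).mono (by decide) (fun _ h => h)
  refine clear2.frame.seq ?_
  rintro s3 ⟨q3, F3⟩
  have h3 := (h1.frame F2 rfl).frame F3 rfl
  have v3 : s3.nvar 11 = v := ((F3.nvar _ rfl).trans (F2.nvar _ rfl)).trans v1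
  have j3 : s3.nvar 13 = j := (F3.nvar _ rfl).trans j2
  have k3 : s3.nvar 12 = k :=
    (((F3.nvar _ rfl).trans (F2.nvar _ rfl)).trans (hF.nvar _ rfl)).trans hk
  have r1 : s3.narr 1 = Function.update (s1.narr 1) j 0 := (F3.narr _ rfl).trans q2
  have r2 : s3.narr 2 = Function.update (s1.narr 2) j 0 := by rw [q3, F2.narr 2 rfl]
  have hs : Test.selected.Holds s3 ↔ Selected n g v k j :=
    holds_selected v3 k3 j3 (fun hjv => by
      rw [F3.narr 6 rfl, F2.narr 6 rfl, hF.narr 6 rfl]; exact h6 j hj hjv)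
  refine (Halts.of_loopFree rfl ?_).mono (by decide) (fun _ h => h)
  intro w hw
  simp only [Prog.exec, hs, Test.holds_adj h3 (show s3.nvar 11 < n by omega)
    (show s3.nvar 13 < n by omega), v3, j3, NExp.eval, State.withN_narr]
  by_cases hwj : w = j
  · subst hwj
    by_cases hS : Selected n g v k w <;> by_cases hA : A v w <;> simp [hS, hA, r1, r2]
  · have hI' := hI w (by omega)
    by_cases hS : Selected n g v k j <;> by_cases hA : A v j <;>
      simp [hS, hA, r1, r2, hwj, hI']

theorem weightStep_halts {s : State} (h : HasInput n A α q s) :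
    Halts weightStep s (n * 20 + 6) (fun s' => ∀ w < n, s'.rarr 3 w = s.rarr 3 w + s.rarr 4 w) := by
  refine (Halts.forUp_const 12 (fun j s' => ∀ w,
      s'.rarr 3 w = if w < j then s.rarr 3 w + s.rarr 4 w else s.rarr 3 w)
    h.size rfl rfl (by decide) (by simp) ?_).mono le_rfl (fun s' h w hw => by rw [h.1 w, if_pos hw])
  intro j hj s1 hF hj1 hI
  have e4 : s1.rarr 4 = s.rarr 4 := hF.rarr _ rfl
  refine (Halts.of_loopFree rfl ?_).mono (by decide) (fun _ h => h)
  intro w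
  simp only [Prog.exec, NExp.eval, RExp.eval, State.withN_rarr, Function.update_self, hj1, e4,
    Function.update_apply]
  by_cases hwj : w = j
  · subst hwj; simp [hI]
  · have : w < j + 1 ↔ w < j := by omega
    simp only [hwj, if_false, hI, this]

/-- The output is correct as far as the strategies in `P` are concerned, where `g v k` are the
weights for the player `v` with `k` outlinks. -/
def IsResult (n : ℕ) (A : ℕ → ℕ → Prop) (g : ℕ → ℕ → ℕ → ℝ) (P : ℕ → ℕ → Prop) (s : State) : Prop :=
  (s.nvar 0 = 1 ∧ ∀ v < n, ∀ k < n, P v k → ¬ 0 < surplus n (g v k) v k) ∨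
  (s.nvar 0 = 0 ∧ ∃ v < n, ∃ k < n, 0 < surplus n (g v k) v k ∧ s.nvar 1 = v ∧ ∀ w < n,
    (s.narr 1 w = 1 ↔ Selected n (g v k) v k w ∧ A v w) ∧
    (s.narr 2 w = 1 ↔ Selected n (g v k) v k w ∧ ¬ A v w))

theorem IsResult.frame {g : ℕ → ℕ → ℕ → ℝ} {P : ℕ → ℕ → Prop} {s s' : State}
    (h : IsResult n A g P s) {p : Prog} (hF : Frame p s s')
    (hp : (p.writesN 0 || p.writesN 1 || p.writesNArr 1 || p.writesNArr 2) = false) :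
    IsResult n A g P s' := by
  simp only [Bool.or_eq_false_iff] at hp
  obtain ⟨⟨⟨p0, p1⟩, p2⟩, p3⟩ := hp
  rw [IsResult, hF.nvar _ p0, hF.nvar _ p1, hF.narr _ p2, hF.narr _ p3]
  exact h

theorem IsResult.mono {g : ℕ → ℕ → ℕ → ℝ} {P P' : ℕ → ℕ → Prop} {s : State}
    (h : IsResult n A g P s) (hP : ∀ v < n, ∀ k < n, P' v k → P v k) : IsResult n A g P' s := by
  rcases h with ⟨h0, h⟩ | h
  · exact .inl ⟨h0, fun v hv k hk hvk => h v hv k hk (hP v hv k hk hvk)⟩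
  · exact .inr h

/-- A success overwrites any stored strategy and a failure leaves it in place. Once one is stored,
the second alternative of `IsResult` no longer refers to the pairs tested, so the search need not
stop. -/
theorem playerRound_halts {s : State} (h : HasInput n A α q s) {g : ℕ → ℕ → ℕ → ℝ}
    {P P' : ℕ → ℕ → Prop} {v k : ℕ}
    (hv : s.nvar 11 = v) (hk : s.nvar 12 = k) (hvn : v < n) (hkn : k < n) (hirr : ¬ A v v)
    (h3 : ∀ w < n, s.rarr 3 w = g v k w)
    (h5 : ∀ w < n, s.narr 5 w = nonRank n A (g v k) v w)
    (hI : IsResult n A g P s) (hP : ∀ a b, P' a b → P a b ∨ a = v ∧ b = k) :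
    Halts playerRound s (n * 170 + dartCount n A v * (n * 100 + 6) + 60) (fun s' =>
      IsResult n A g P' s' ∧ ∀ w < n, s'.rarr 3 w = s.rarr 3 w + s.rarr 4 w) := by
  have h5' : ∀ w < n, s.narr 5 w = nonRank n A (s.rarr 3) v w := fun w hw => by
    rw [h5 w hw]; exact nonRank_congr hw fun y hy _ => (h3 y hy).symm
  refine Halts.mono (B := (n * 50 + dartCount n A v * (n * 100 + 6) + 12) + (2 + ((n * 40 + 6) +
    ((n * 60 + 20) + (n * 20 + 6))))) ?_ (by omega) (fun _ h => h)
  refine (rankPhase_halts h hv hvn hirr h5').frame.seq ?_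
  rintro s1 ⟨q1, F1⟩
  refine Halts.seq (Halts.of_loopFree (Q := fun s' => s'.rvar 6 = 0) rfl
    (by simp [Prog.exec, RExp.eval])).frame ?_
  rintro s2 ⟨z2, F2⟩
  have h2 := (h.frame F1 rfl).frame F2 rfl
  have v2 : s2.nvar 11 = v := ((F2.nvar _ rfl).trans (F1.nvar _ rfl)).trans hv
  have k2 : s2.nvar 12 = k := ((F2.nvar _ rfl).trans (F1.nvar _ rfl)).trans hk
  have g2 : s2.rarr 3 = s.rarr 3 := (F2.rarr _ rfl).trans (F1.rarr _ rfl)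
  have q2 : ∀ w < n, w ≠ v → s2.narr 6 w = fullRank n (s2.rarr 3) v w := by
    rw [F2.narr 6 rfl, g2]; exact q1
  refine (surplusLoop_halts h2 v2 k2 z2 q2).frame.seq ?_
  rintro s3 ⟨q3, F3⟩
  have hI3 : IsResult n A g P s3 := ((hI.frame F1 rfl).frame F2 rfl).frame F3 rfl
  have h3' := h2.frame F3 rfl
  have v3 : s3.nvar 11 = v := (F3.nvar _ rfl).trans v2
  have k3 : s3.nvar 12 = k := (F3.nvar _ rfl).trans k2
  have g3 : s3.rarr 3 = s.rarr 3 := (F3.rarr _ rfl).trans g2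
  have i3 : s3.rarr 4 = s.rarr 4 := ((F3.rarr _ rfl).trans (F2.rarr _ rfl)).trans (F1.rarr _ rfl)
  rw [g2, surplus_congr h3] at q3
  refine Halts.seq (Q := fun s' => IsResult n A g P' s' ∧
    HasInput n A α q s' ∧ s'.rarr 3 = s.rarr 3 ∧ s'.rarr 4 = s.rarr 4) ?_ ?_
  · by_cases hpos : 0 < s3.rvar 6
    · have hT : (Test.rlt .zero (.var 6)).Holds s3 := hpos
      have hpre : Halts (.seq (.setN 0 (.const 0)) (.setN 1 (.var 11))) s3 4
          (fun s' => s'.nvar 0 = 0 ∧ s'.nvar 1 = v) :=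
        Halts.of_loopFree rfl (by simp [Prog.exec, NExp.eval, v3])
      refine (Halts.ite_of_pos hT (Halts.seq hpre.frame (C := n * 60 + 6)
        (R := fun s' => IsResult n A g P' s' ∧ HasInput n A α q s' ∧
          s'.rarr 3 = s.rarr 3 ∧ s'.rarr 4 = s.rarr 4) ?_)).mono
        (by simp only [Test.cost, RExp.cost]; omega) (fun _ h => h)
      rintro s4 ⟨⟨z4, p4⟩, F4⟩
      have h4 := h3'.frame F4 rfl
      refine (outputLoop_halts (g := g v k) h4 ((F4.nvar _ rfl).trans v3) ((F4.nvar _ rfl).trans k3)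
        hvn ?_).frame.mono le_rfl ?_
      · intro w hw hwv
        rw [F4.narr 6 rfl, F3.narr 6 rfl, q2 w hw hwv, g2]
        exact fullRank_congr hw h3
      · rintro s5 ⟨q5, F5⟩
        refine ⟨.inr ⟨(F5.nvar _ rfl).trans z4, v, hvn, k, hkn, q3 ▸ hpos,
          (F5.nvar _ rfl).trans p4, q5⟩, h4.frame F5 rfl, ?_, ?_⟩
        · rw [F5.rarr 3 rfl, F4.rarr 3 rfl, g3]
        · rw [F5.rarr 4 rfl, F4.rarr 4 rfl, i3]
    · have hT : ¬ (Test.rlt .zero (.var 6)).Holds s3 := hpos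
      refine (Halts.ite_of_neg hT (Halts.of_loopFree rfl ?_)).mono ?_ (fun _ h => h)
      · refine ⟨?_, h3', g3, i3⟩
        rcases hI3 with ⟨h0, hI3⟩ | hI3
        · refine .inl ⟨h0, fun a ha b hb hab => ?_⟩
          rcases hP a b hab with h6 | ⟨rfl, rfl⟩
          · exact hI3 a ha b hb h6
          · rwa [← q3]
        · exact .inr hI3
      · simp only [Test.cost, RExp.cost, Prog.maxCost]; omega
  · rintro s4 ⟨hI4, h4, g4, i4⟩
    refine (weightStep_halts h4).frame.mono le_rfl ?_
    rintro s5 ⟨q5, F5⟩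
    exact ⟨hI4.frame F5 rfl, fun w hw => by rw [q5 w hw, g4, i4]⟩

theorem playerPhase_halts {s : State} (h : HasInput n A α q s) (hirr : ∀ v, ¬ A v v)
    (hin : ∀ v < n, ∀ u < n, ¬ A v u → inflowVal n q (s.rarr 2) (s.narr 4) v u = 0)
    (h0 : s.nvar 0 = 1) :
    Halts playerPhase s
      ((∑ v ∈ Finset.range n, ((n * (n * 100 + 230) + 70 +
        (n * ((n * 170 + dartCount n A v * (n * 100 + 6) + 60) + 8) + 6)) + 8)) + 6)
      (IsResult n A (weightVal n A α q (s.rarr 2) (s.narr 4)) (fun _ _ => True)) := by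
  set g := weightVal n A α q (s.rarr 2) (s.narr 4) with hg
  refine (Halts.forUp (c := fun v => n * (n * 100 + 230) + 70 +
        (n * ((n * 170 + dartCount n A v * (n * 100 + 6) + 60) + 8) + 6))
    (fun j s' => IsResult n A g (fun v _ => v < j) s') h.size rfl rfl (by decide) ?_ ?_).mono le_rfl ?_
  · exact .inl ⟨by simpa using h0, fun v _ k _ hv => absurd hv (Nat.not_lt_zero v)⟩
  · intro v hv s1 F1 v1 hI1
    have h1 := h.frame F1 rfl
    have f1 : s1.rarr 2 = s.rarr 2 := F1.rarr _ rfl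
    have b1 : s1.narr 4 = s.narr 4 := F1.narr _ rfl
    have hinit := playerInit_halts h1 v1 hv
    rw [f1, b1, ← hg] at hinit
    refine hinit.frame.seq ?_
    rintro s2 ⟨⟨q3, q4, q5⟩, F2⟩
    have h2 := h1.frame F2 rfl
    have v2 : s2.nvar 11 = v := (F2.nvar _ rfl).trans v1
    refine (Halts.forUp_const _ (fun k s' => IsResult n A g (fun v' k' => v' < v ∨ v' = v ∧ k' < k) s' ∧
      ∀ w < n, s'.rarr 3 w = g v k w) h2.size rfl rfl (by decide) ?_ ?_).mono le_rfl ?_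
    · refine ⟨IsResult.mono (s := s2.withN 12 0) ?_ (P := fun v' _ => v' < v) ?_, q3⟩
      · have := hI1.frame F2 rfl
        exact this
      · intro a _ b _ hab
        simpa using hab
    · rintro k hk s3 F3 k3 ⟨hI3, g3⟩
      refine (playerRound_halts (h2.frame F3 rfl) ((F3.nvar _ rfl).trans v2) k3 hv hk (hirr v) g3
        ?_ hI3 (P' := fun v' k' => v' < v ∨ v' = v ∧ k' < k + 1) ?_).mono le_rfl ?_
      · intro w hw
        rw [F3.narr 5 rfl, q5 w hw]
        refine nonRank_congr hw fun y hy hAy => ?_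
        rw [hg]
        -- The weight of a non-neighbour is the same for `k` as for 0, so the ranks from
        -- `playerInit` can be reused.
        simp only [weightVal, hin v hv y hy hAy, mul_zero]
      · intro a b; omega
      · rintro s4 ⟨hI4, g4⟩
        refine ⟨hI4, fun w hw => ?_⟩
        rw [State.withN_rarr, g4 w hw, g3 w hw, F3.rarr 4 rfl, q4 w hw, hg]
        simp only [weightVal, Nat.cast_add, Nat.cast_one]
        ring
    · rintro s3 ⟨⟨hI3, -⟩, -⟩
      refine IsResult.mono (s := s3.withN 11 (v + 1)) hI3 fun a _ b hb hab => ?_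
      beta_reduce at hab ⊢
      omega
  · rintro s1 ⟨hI1, -⟩
    exact hI1.mono fun v hv _ _ _ => hv

end Round

/-! ### The whole program -/

/-- Computes the offsets of the rows of an adjacency matrix. -/
def rowPhase : Prog :=
  .forUp 11 (.seq (.putN 3 (.var 11) (.var 20)) (.setN 20 (.add (.var 20) (.var 10))))

/-- Prepares the memory. -/
def startup : Prog :=
  .seq (.seq (.setN 10 (.var 0)) (.seq (.setN 0 (.const 1)) (.setN 20 (.const 0)))) rowPhase

/-- Decides whether a tree is a Nash equilibrium. -/
def nashProg : Prog :=
  .seq startup (.seq ratioPhase (.seq hitPhase playerPhase))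

section Main

variable {n : ℕ} {G : SimpleGraph (Fin n)} {α : ℝ} {q : Fin n → ℝ}

/-- The adjacency relation on natural numbers. -/
def natAdj (G : SimpleGraph (Fin n)) (u w : ℕ) : Prop :=
  ∃ (hu : u < n) (hw : w < n), G.Adj ⟨u, hu⟩ ⟨w, hw⟩

theorem natAdj_coe {u w : Fin n} : natAdj G u w ↔ G.Adj u w :=
  ⟨fun ⟨_, _, h⟩ => h, fun h => ⟨u.2, w.2, h⟩⟩

/-- The extension of a function of two nodes to natural numbers. -/
def natExt (f : Fin n → Fin n → ℕ) (u w : ℕ) : ℕ :=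
  if h : u < n ∧ w < n then f ⟨u, h.1⟩ ⟨w, h.2⟩ else 0

theorem natExt_mk {f : Fin n → Fin n → ℕ} {u w : ℕ} (hu : u < n) (hw : w < n) :
    natExt f u w = f ⟨u, hu⟩ ⟨w, hw⟩ := dif_pos ⟨hu, hw⟩

theorem isDartRank_sideCard (hG : G.IsTree) :
    IsDartRank n (natAdj G) (natExt (sideCard G)) where
  irrefl := fun _ ⟨_, _, h⟩ => G.loopless.irrefl _ h
  pos := fun w p ⟨hw, hp, h⟩ => by rw [natExt_mk hw hp]; exact sideCard_pos h
  le := fun w p ⟨hw, hp, h⟩ => by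
    rw [natExt_mk hw hp]; exact (sideCard_le G _ _).trans (Fintype.card_fin n).le
  lt := fun w p c ⟨hw, hp, h⟩ ⟨_, hc, h'⟩ hcp => by
    rw [natExt_mk hw hp, natExt_mk hc hw]
    exact sideCard_lt hG h h' fun e => hcp (congrArg Fin.val e)

theorem isTreeDist_dist (hG : G.IsTree) : IsTreeDist n (natAdj G) (natExt G.dist) where
  self := fun v hv => by rw [natExt_mk hv hv]; exact SimpleGraph.dist_self
  symm := fun u w ⟨hu, hw, h⟩ => ⟨hw, hu, h.symm⟩
  dichotomy := fun v hv w hw p hp ⟨_, _, h⟩ => by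
    rw [natExt_mk hv hw, natExt_mk hv hp]; exact hG.dist_eq_dist_add_one_of_adj _ h
  unique := fun v hv w hw p hp p' hp' ⟨_, _, h⟩ ⟨_, _, h'⟩ hd hd' => by
    rw [natExt_mk hv hw, natExt_mk hv hp] at hd
    rw [natExt_mk hv hw, natExt_mk hv hp'] at hd'
    exact congrArg Fin.val (eq_of_adj_dist_succ hG h h' hd hd')
  parent := fun v hv w hw hwv => by
    obtain ⟨p, hp, hd⟩ := exists_adj_dist_succ hG.connected (v := ⟨v, hv⟩) (w := ⟨w, hw⟩)
      (fun e => hwv (congrArg Fin.val e))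
    exact ⟨p, p.2, ⟨hw, p.2, hp⟩, by rw [natExt_mk hv hw, natExt_mk hv p.2]; exact hd⟩
  lt := fun v hv w hw => by
    rw [natExt_mk hv hw]
    obtain ⟨p, hp, hl⟩ := hG.connected.exists_path_of_dist ⟨v, hv⟩ ⟨w, hw⟩
    rw [← hl]
    exact hp.length_lt.trans_eq (Fintype.card_fin n)

/-- Handshake lemma: a tree with `n` nodes has `n - 1` edges. -/
theorem sum_dartCount_le (hG : G.IsTree) :
    ∑ w ∈ Finset.range n, dartCount n (natAdj G) w ≤ 2 * n := by
  classical
  have h : ∑ w ∈ Finset.range n, dartCount n (natAdj G) w = ∑ w, G.degree w := by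
    rw [Finset.sum_range]
    refine Finset.sum_congr rfl fun w _ => ?_
    rw [dartCount, Finset.sum_range, ← SimpleGraph.card_neighborFinset_eq_degree,
      SimpleGraph.neighborFinset_eq_filter, Finset.card_filter]
    exact Finset.sum_congr rfl fun u _ => if_congr natAdj_coe rfl rfl
  have h1 := hG.card_edgeFinset
  rw [Fintype.card_fin] at h1
  rw [h, SimpleGraph.sum_degrees_eq_twice_card_edges]
  omega

/-- The jump distribution, extended by zero. -/
noncomputable def natJump (q : Fin n → ℝ) (k : ℕ) : ℝ := if h : k < n then q ⟨k, h⟩ else 0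

theorem natJump_coe (w : Fin n) : natJump q w = q w := dif_pos w.2

theorem narr_input_pos {u w : ℕ} (hu : u < n) (hw : w < n) :
    0 < (input G α q).narr 0 (u * n + w) ↔ natAdj G u w := by
  classical
  simp only [input, true_and]
  constructor
  · intro h
    split_ifs at h with h'
    · obtain ⟨u', w', he, ha⟩ := h'
      obtain ⟨rfl, rfl⟩ := (entry_inj w'.2 hw).1 he
      exact ⟨hu, hw, ha⟩
    · omega
  · rintro ⟨hu, hw, ha⟩
    rw [if_pos ⟨⟨u, hu⟩, ⟨w, hw⟩, rfl, ha⟩]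
    exact Nat.one_pos

/-- Integers cannot be multiplied, so the row offsets `u * n` are accumulated by addition. The size
moves to variable 10 to free variable 0 for the answer, preset to yes. -/
theorem startup_halts :
    Halts startup (input G α q) (n * 20 + 20) (fun s => HasInput n (natAdj G) α (natJump q) s ∧
        s.nvar 0 = 1 ∧ s.narr 4 = fun _ => 0) := by
  have hpre : Halts (.seq (.setN 10 (.var 0)) (.seq (.setN 0 (.const 1)) (.setN 20 (.const 0))))
      (input G α q) 14 (fun s => s.nvar 10 = n ∧ s.nvar 0 = 1 ∧ s.nvar 20 = 0) :=
    (Halts.of_loopFree rfl (by simp [Prog.exec, NExp.eval, input])).mono (by decide) (fun _ h => h)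
  refine (hpre.frame.seq (C := n * 20 + 6) ?_).mono (by omega) (fun _ h => h)
  rintro s1 ⟨⟨e10, e0, e20⟩, F1⟩
  refine (Halts.forUp_const 12 (fun j s' => s'.nvar 20 = j * n ∧ ∀ u < j, s'.narr 3 u = u * n)
    e10 rfl rfl (by decide) (by simp [e20]) ?_).mono le_rfl ?_
  · rintro j hj s2 F2 j2 ⟨hI, hI'⟩
    have e10' : s2.nvar 10 = n := (F2.nvar _ rfl).trans e10
    refine (Halts.of_loopFree rfl ?_).mono (by decide) (fun _ h => h)
    refine ⟨by simp [Prog.exec, NExp.eval, hI, e10']; ring, fun u hu => ?_⟩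
    simp only [Prog.exec, NExp.eval, State.withN_narr, Function.update_self, Function.update_apply,
      j2, hI]
    split_ifs with huj
    · rw [huj]
    · exact hI' u (by omega)
  · rintro s2 ⟨⟨-, hI⟩, F2⟩
    have a : s2.narr 0 = (input G α q).narr 0 := (F2.narr _ rfl).trans (F1.narr _ rfl)
    refine ⟨⟨(F2.nvar _ rfl).trans e10, hI, fun u hu w hw => by rw [a]; exact narr_input_pos hu hw,
      ?_, ?_⟩, (F2.nvar _ rfl).trans e0, ?_⟩
    · rw [F2.rvar 0 rfl, F1.rvar 0 rfl]; simp [input]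
    · rw [F2.rarr 0 rfl, F1.rarr 0 rfl]
      funext k
      simp [input, natJump]
    · rw [F2.narr 4 rfl, F1.narr 4 rfl]
      funext k
      simp [input]

/-! #### From the memory to the tree -/

/-- The computed ratios. -/
def ratioOf (f : ℕ → ℝ) (w p : Fin n) : ℝ := f (w * n + p)

theorem isRatio_ratioOf {f : ℕ → ℝ} (h : ∀ w < n, ∀ p < n, natAdj G w p →
    f (w * n + p) = ratioVal n (natAdj G) α f w p) : IsRatio G α (ratioOf f) := by
  classical
  intro w p hwp
  rw [ratioOf, h w w.2 p p.2 (natAdj_coe.2 hwp), ratioVal, ratioStep, Finset.sum_range]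
  congr 2
  refine Finset.sum_congr rfl fun c _ => ?_
  by_cases hc : G.Adj w c ∧ c ≠ p
  · rw [if_pos hc, if_pos ⟨natAdj_coe.2 hc.1, fun e => hc.2 (Fin.ext e)⟩, ratioOf]
  · rw [if_neg hc, if_neg fun h' => hc ⟨natAdj_coe.1 h'.1, fun e => h'.2 (congrArg _ e)⟩]

/-- The computed hitting probabilities of the node `v`. -/
def hitOf (f : ℕ → ℝ) (v w : Fin n) : ℝ := f (v * n + w)

/-- The computed branches at the node `v`. -/
def branchOf (b : ℕ → ℕ) (v w : Fin n) : Fin n :=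
  if h : b (v * n + w) - 1 < n then ⟨b (v * n + w) - 1, h⟩ else v

theorem isHitTable_hitOf {r f : ℕ → ℝ} {b : ℕ → ℕ} {v : Fin n}
    (h : HitInv n (natAdj G) (natExt G.dist) r f b v) (hb : ∀ w < n, b (v * n + w) ≠ 0) :
    IsHitTable G (ratioOf r) v (hitOf f v) (branchOf b v) where
  self := h.self.1
  mul := fun w p hwp hd => (h.step w w.2 p p.2 (natAdj_coe.2 hwp)
    (by rw [natExt_mk v.2 w.2, natExt_mk v.2 p.2]; exact hd) (hb w w.2)).2.1
  adj := fun w hwv => by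
    have := (h.step w w.2 v v.2 (natAdj_coe.2 hwv) (by
      rw [natExt_mk v.2 w.2, natExt_mk v.2 v.2]
      simpa using hwv.symm) (hb w w.2)).2.2
    rw [if_pos rfl] at this
    simp [branchOf, this]
  branch := fun w p hwp hd hpv => by
    have := (h.step w w.2 p p.2 (natAdj_coe.2 hwp)
      (by rw [natExt_mk v.2 w.2, natExt_mk v.2 p.2]; exact hd) (hb w w.2)).2.2
    rw [if_neg (fun e => hpv (Fin.ext e))] at this
    simp [branchOf, this]

theorem inflowVal_eq {f : ℕ → ℝ} {b : ℕ → ℕ} {v : Fin n}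
    (hb : ∀ w, w ≠ v → G.Adj v (branchOf b v w)) (u : Fin n) :
    inflowVal n (natJump q) f b v u = inflow q v (hitOf f v) (branchOf b v) u := by
  rw [inflowVal, inflow, Finset.sum_range]
  refine Finset.sum_congr rfl fun w _ => ?_
  rw [natJump_coe]
  refine if_congr ?_ rfl rfl
  rw [ne_eq, ne_eq, Fin.val_inj]
  refine and_congr_right fun hwv => ?_
  have h1 := hb w hwv
  unfold branchOf at h1 ⊢
  split_ifs at h1 ⊢ with h2
  · rw [Fin.ext_iff]
  -- `branchOf` falls back to `v` on a label out of range; a branch is adjacent to `v`, so this does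
  -- not occur for `w ≠ v`.
  · exact absurd h1 (G.loopless.irrefl v)

theorem weightVal_eq {f : ℕ → ℝ} {b : ℕ → ℕ} {v : Fin n}
    (hb : ∀ w, w ≠ v → G.Adj v (branchOf b v w)) (k : ℕ) (w : Fin n) :
    weightVal n (natAdj G) α (natJump q) f b v k w
      = weight G α q v (hitOf f v) (branchOf b v) k w := by
  classical
  have : baseVal n (natAdj G) α (natJump q) f v = baseValue G α q v (hitOf f v) := by
    rw [baseVal, baseValue, Finset.sum_range, Finset.sum_range, Finset.sum_range]
    simp only [natJump_coe, natAdj_coe]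
    rfl
  rw [weightVal, weight, this, inflowVal_eq hb, natJump_coe]
  rfl

theorem selected_iff_mem_topSet {g : ℕ → ℝ} {g' : Fin n → ℝ} {v : Fin n} {k : ℕ}
    (h : ∀ w : Fin n, g w = g' w) (w : Fin n) : Selected n g v k w ↔ w ∈ topSet v g' k := by
  classical
  rw [Selected, topSet, Finset.mem_filter, Finset.mem_erase, ne_eq, Fin.val_inj,
    and_iff_left (Finset.mem_univ w)]
  refine and_congr_right fun _ => ?_
  have : fullRank n g v w = rankIn (Beats g') (Finset.univ.erase v) w := by
    rw [fullRank, Finset.sum_range, Finset.sum_boole, Nat.cast_id, rankIn]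
    congr 1
    ext y
    simp only [Finset.mem_filter, Finset.mem_erase, Finset.mem_univ, true_and, and_true, ne_eq,
      Fin.val_inj]
    refine and_congr_right fun _ => ?_
    simp only [Beats, h, Fin.val_fin_lt]
  rw [this]

theorem surplus_eq {g : ℕ → ℝ} {g' : Fin n → ℝ} {v : Fin n} {k : ℕ}
    (h : ∀ w : Fin n, g w = g' w) : surplus n g v k = ∑ w ∈ topSet v g' k, g' w := by
  classical
  rw [surplus, Finset.sum_range, ← Finset.sum_filter]
  refine Finset.sum_congr ?_ fun w _ => h w
  ext w
  rw [Finset.mem_filter, and_iff_right (Finset.mem_univ w), selected_iff_mem_topSet h]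

/-- `D` is the sum of the degrees. The summands belong to startup, ratios, hitting probabilities and
players; `D ≤ 2 * n` makes each of them at most cubic. -/
theorem cost_le {D : ℕ} (hn : 1 ≤ n) (hD : D ≤ 2 * n) :
    (n * 20 + 20) + ((n * ((n * (n * 20 + 14) + D * (n * 50 + 20) + 6) + 8) + 6) +
      ((n * 30 + 6 + (n * ((n * (n * 20 + 14) + D * (n * 88 + 6) + 6) + 8) + 6)) +
      ((n * (n * (n * 270 + 298) + 84) + D * (n * (n * 100 + 6))) + 6))) ≤ 3000 * n ^ 3 := by
  have h1 : n ≤ n ^ 3 := Nat.le_self_pow (by norm_num) n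
  have h2 : n ^ 2 ≤ n ^ 3 := Nat.pow_le_pow_right hn (by norm_num)
  have h3 : 1 ≤ n ^ 3 := Nat.one_le_pow _ _ hn
  have e1 : D * (n * 50 + 20) ≤ 2 * n * (n * 50 + 20) := Nat.mul_le_mul_right _ hD
  have e2 : D * (n * 88 + 6) ≤ 2 * n * (n * 88 + 6) := Nat.mul_le_mul_right _ hD
  have e3 : D * (n * (n * 100 + 6)) ≤ 2 * n * (n * (n * 100 + 6)) := Nat.mul_le_mul_right _ hD
  have f1 := Nat.mul_le_mul_left n e1
  have f2 := Nat.mul_le_mul_left n e2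
  nlinarith

theorem nashProg_halts (hG : G.IsTree) (h0 : 0 < α) (h1 : α < 1)
    (hq : q ∈ stdSimplex ℝ (Fin n)) :
    Halts nashProg (input G α q) (3000 * n ^ 3) (fun s =>
      (IsNash G α q → s.answer = 1) ∧
        (¬ IsNash G α q → s.answer = 0 ∧ ∃ v : Fin n, s.player = (v : ℕ) ∧
          IsImproving G α q v (s.retainedSet n) (s.requestedSet n))) := by
  classical
  have hn : 1 ≤ n := Fin.pos hG.connected.nonempty.some
  have hD := sum_dartCount_le hG
  set D := ∑ w ∈ Finset.range n, dartCount n (natAdj G) w with hDdef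
  have hsum : ∀ a c : ℕ, ∑ w ∈ Finset.range n, (a + dartCount n (natAdj G) w * c)
      = n * a + D * c := by
    intro a c
    rw [Finset.sum_add_distrib, ← Finset.sum_mul, Finset.sum_const, Finset.card_range, smul_eq_mul]
  refine Halts.mono (B := (n * 20 + 20) +
      ((n * ((n * (n * 20 + 14) + D * (n * 50 + 20) + 6) + 8) + 6) +
      ((n * 30 + 6 + (n * ((n * (n * 20 + 14) + D * (n * 88 + 6) + 6) + 8) + 6)) +
      ((n * (n * (n * 270 + 298) + 84) + D * (n * (n * 100 + 6))) + 6)))) ?_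
    (cost_le hn hD) (fun _ h => h)
  refine startup_halts.seq ?_
  rintro s1 ⟨i1, z1, b1⟩
  refine (((ratioPhase_halts (isDartRank_sideCard hG) i1).frame.mono (le_of_eq ?_)
    (fun _ h => h)).seq ?_)
  · have := hsum (n * 20 + 14) (n * 50 + 20)
    rw [← this]
    congr 5
    funext w
    ring
  rintro s2 ⟨q2, F2⟩
  have i2 := i1.frame F2 rfl
  have b2 : s2.narr 4 = fun _ => 0 := (F2.narr _ rfl).trans b1
  refine (((hitPhase_halts (isTreeDist_dist hG) i2 b2).frame.mono (le_of_eq ?_)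
    (fun _ h => h)).seq ?_)
  · have := hsum (n * 20 + 14) (n * 88 + 6)
    rw [← this]
    congr 6
    funext w
    ring
  rintro s3 ⟨q3, F3⟩
  have i3 := i2.frame F3 rfl
  have hr : IsRatio G α (ratioOf (s2.rarr 1)) := isRatio_ratioOf q2
  have hT : ∀ v : Fin n, IsHitTable G (ratioOf (s2.rarr 1)) v (hitOf (s3.rarr 2) v)
      (branchOf (s3.narr 4) v) := fun v => isHitTable_hitOf (q3 v v.2).1 (q3 v v.2).2
  have hb : ∀ v w : Fin n, w ≠ v → G.Adj v (branchOf (s3.narr 4) v w) := fun v w hw =>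
    (((hT v).bounds hr hG h0 h1 w).2.2 hw).2.1
  have hw := fun (v : Fin n) => weightVal_eq (α := α) (q := q) (f := s3.rarr 2) (hb v)
  have z3 : s3.nvar 0 = 1 := ((F3.nvar _ rfl).trans (F2.nvar _ rfl)).trans z1
  refine (playerPhase_halts i3 (isDartRank_sideCard hG).irrefl ?_ z3).mono (le_of_eq ?_) ?_
  · intro v hv u hu hA
    rw [inflowVal_eq (hb ⟨v, hv⟩) ⟨u, hu⟩]
    exact inflow_eq_zero (hb ⟨v, hv⟩) fun h => hA ⟨hv, hu, h⟩
  · rw [← hsum]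
    refine congrArg (· + 6) (Finset.sum_congr rfl fun w _ => ?_)
    ring
  · rintro s4 (⟨a4, hall⟩ | ⟨a4, v, hv, k, hk, hpos, p4, hout⟩)
    · have hNash : IsNash G α q := by
        intro v E F hS
        by_contra hlt
        -- A violated best response would give a positive top set for some `k < n`, and all of these
        -- were tested.
        obtain ⟨k, hk, hpos⟩ := exists_topSet_of_isImproving hG h0 h1 hq hr (hT v)
          ⟨hS, not_le.1 hlt⟩
        refine hall v v.2 k hk trivial ?_
        rwa [surplus_eq (hw v k)]
      exact ⟨fun _ => a4, fun h => absurd hNash h⟩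
    · lift v to Fin n using hv
      rw [surplus_eq (hw v k)] at hpos
      have himp := isImproving_topSet hG h0 h1 hq hr (hT v) hk hpos
      have hE : s4.retainedSet n = {w | w ∈ topSet v (weight G α q v (hitOf (s3.rarr 2) v)
          (branchOf (s3.narr 4) v) k) k ∧ G.Adj v w} := by
        ext w
        rw [State.retainedSet, Set.mem_ofPred_eq, Set.mem_ofPred_eq, (hout w w.2).1,
          selected_iff_mem_topSet (hw v k), natAdj_coe]
      have hF : s4.requestedSet n = {w | w ∈ topSet v (weight G α q v (hitOf (s3.rarr 2) v)
          (branchOf (s3.narr 4) v) k) k ∧ ¬ G.Adj v w} := by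
        ext w
        rw [State.requestedSet, Set.mem_ofPred_eq, Set.mem_ofPred_eq, (hout w w.2).2,
          selected_iff_mem_topSet (hw v k), natAdj_coe]
      rw [← hE, ← hF] at himp
      exact ⟨fun hN => absurd himp.2 (not_lt.2 (hN v _ _ himp.1)), fun _ => ⟨a4, v, p4, himp⟩⟩

end Main

end PageRankGame

theorem theorem4p4 :
    ∃ (p : Prog) (C : ℕ), ∀ (n : ℕ) (G : SimpleGraph (Fin n)) (α : ℝ) (q : Fin n → ℝ),
      G.IsTree → 0 < α → α < 1 → q ∈ stdSimplex ℝ (Fin n) →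
      ∃ (s : State) (t : ℕ), Runs p (input G α q) s t ∧ t ≤ C * n ^ 3 ∧
        (IsNash G α q → s.answer = 1) ∧
        (¬ IsNash G α q → s.answer = 0 ∧ ∃ v : Fin n, s.player = (v : ℕ) ∧
          IsImproving G α q v (s.retainedSet n) (s.requestedSet n)) :=
  ⟨nashProg, 3000, fun _ _ _ _ hG h0 h1 hq => nashProg_halts hG h0 h1 hq⟩
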